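/- Let $S\subset\mathbb A^3$ be a regular elliptical surface: a smooth surface such that at every point $P$ there is an affine coordinate system with origin $P$ in which $S$ is, near $P$, the graph of a smooth function $$z=\tfrac12(x^2+y^2)+\tfrac16(x^3-3xy^2)+\cdots .$$ Let $(e_1,e_2,e_3,r)$ be a smooth moving frame on (an open part of) $S$: $r$ is the position vector, and at each point $r$ the axes $e_1,e_2,e_3$ are those of such a coordinate system. The fundamental curvatures $I_{40},I_{31},I_{22},I_{13},I_{04}$ are the fourth order coefficients in $$z=\tfrac12(x^2+y^2)+\tfrac16(x^3-3xy^2)+\tfrac1{24}\left(I_{40}x^4+4I_{31}x^3y+6I_{22}x^2y^2+4I_{13}xy^3+I_{04}y^4\right)+\cdots,$$ the invariant 1-forms $w_1,w_2$ are given by $dr=w_1e_1+w_2e_2$, and $D^1,D^2$ by $df=D^1f\,w_1+D^2f\,w_2$. Put $$Y_1=\tfrac23I_{13},\qquad Y_2=\tfrac14I_{40}-\tfrac12I_{22}-\tfrac1{12}I_{04},$$ $$\Omega=\begin{pmatrix}w_{11}&w_{12}&w_{13}&w_1\\w_{21}&w_{22}&w_{23}&w_2\\w_{31}&w_{32}&w_{33}&0\\0&0&0&0\end{pmatrix},\qquad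 w_{ij}=R^1_{ij}w_1+R^2_{ij}w_2,$$ $$R^1=\begin{pmatrix}-\frac{I_{40}}4+\frac{3I_{22}}4-\frac12&-\frac{I_{31}}4+\frac{I_{13}}{12}&-\frac{I_{40}}4-\frac{I_{22}}4+\frac12\\ \frac{I_{31}}4-\frac{I_{13}}{12}&-\frac{I_{40}}4+\frac{3I_{22}}4+\frac12&-\frac{I_{31}}4-\frac{I_{13}}4\\1&0&-\frac{I_{40}}2+\frac{3I_{22}}2\end{pmatrix},$$ $$R^2=\begin{pmatrix}-\frac{I_{31}}4+\frac{3I_{13}}4&-\frac{I_{22}}4+\frac{I_{04}}{12}+\frac12&-\frac{I_{31}}4-\frac{I_{13}}4\\ \frac{I_{22}}4-\frac{I_{04}}{12}+\frac12&-\frac{I_{31}}4+\frac{3I_{13}}4&-\frac{I_{22}}4-\frac{I_{04}}4+\frac12\\0&1&-\frac{I_{31}}2+\frac{3I_{13}}2\end{pmatrix}.$$ Then: (a) The forms $w_1,w_2$ are smooth and pointwise linearly independent, the $I_{ij}$ are smooth, $d(e_1,e_2,e_3,r)=(e_1,e_2,e_3,r)\,\Omega$, $d\Omega+\Omega\wedge\Omega=0$,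 and the following six compatibility conditions hold: $$36D^2I_{31}-36D^1I_{22}-12D^2I_{13}+12D^1I_{04}-9I_{40}I_{22}+3I_{40}I_{04}-24I_{31}I_{13}+18I_{22}^2-3I_{22}I_{04}+8I_{13}^2-I_{04}^2-18I_{40}-36I_{22}-18I_{04}=0,$$ $$12D^2I_{40}-12D^1I_{31}+12D^2I_{22}-12D^1I_{13}-3I_{40}I_{31}-23I_{40}I_{13}+18I_{31}I_{22}+5I_{31}I_{04}-6I_{22}I_{13}+I_{13}I_{04}+48I_{13}=0,$$ $$12D^2I_{31}-12D^1I_{22}+12D^2I_{13}-12D^1I_{04}-3I_{40}I_{22}-7I_{40}I_{04}-16I_{31}I_{13}+18I_{22}^2+15I_{22}I_{04}-16I_{13}^2+I_{04}^2+18I_{40}-36I_{22}-6I_{04}=0,$$ $$12D^2I_{40}-12D^1I_{31}-36D^2I_{22}+36D^1I_{13}-3I_{40}I_{31}+I_{40}I_{13}+6I_{31}I_{22}+I_{31}I_{04}+6I_{22}I_{13}-3I_{13}I_{04}=0,$$ $$dw_1=Y_1\,w_1\wedge w_2,\qquad dw_2=Y_2\,w_1\wedge w_2.$$ (b) These six conditions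 are exactly the content of the structure equation: for arbitrary smooth, pointwise linearly independent 1-forms $w_1,w_2$ and arbitrary smooth functions $I_{40},I_{31},I_{22},I_{13},I_{04}$ on an open set $U\subset\mathbb R^2$, with $D^k$, $Y_k$, $\Omega$ defined from them by the formulas above, one has $d\Omega+\Omega\wedge\Omega=0$ on $U$ if and only if the six conditions hold on $U$. -/

import Mathlib

open Filter Topology Asymptotics
open scoped ContDiff

namespace AffineSurface

/-- The parameter plane of a local parametrization of a surface. -/
abbrev Plane := ℝ × ℝ

/-- The affine space `A³` in affine coordinates. -/
abbrev A3 := Fin 3 → ℝ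

/-! ### Differential forms on the parameter plane -/

/-- A differential 1-form on (a part of) the parameter plane. -/
abbrev OneForm := Plane → (Plane →L[ℝ] ℝ)

/-- The exterior derivative of a 1-form, `dα (u, v) = (∂_u α) v - (∂_v α) u`. -/
noncomputable def d (α : OneForm) (p u v : Plane) : ℝ :=
  extDeriv (fun q => ContinuousAlternatingMap.ofSubsingleton ℝ Plane ℝ (0 : Fin 1) (α q)) p ![u, v]

/-- The exterior derivative of a 1-form in terms of its Fréchet derivative. -/
theorem d_apply {α : OneForm} {p : Plane} (h : DifferentiableAt ℝ α p) (u v : Plane) :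
    d α p u v = fderiv ℝ α p u v - fderiv ℝ α p v u := by
  have h2 : HasFDerivAt
      (fun q => ContinuousAlternatingMap.ofSubsingleton ℝ Plane ℝ (0 : Fin 1) (α q)) _ p :=
    (ContinuousAlternatingMap.ofSubsingletonLIE (𝕜 := ℝ) (E := Plane) (F := ℝ) (ι := Fin 1)
      0).toContinuousLinearEquiv.toContinuousLinearMap.hasFDerivAt.comp p h.hasFDerivAt
  unfold d
  rw [extDeriv, h2.fderiv, ContinuousAlternatingMap.alternatizeUncurryFin_apply]
  erw [Fin.sum_univ_two]
  simp only [Fin.val_zero, pow_zero, one_smul]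
  rw [sub_eq_add_neg]
  simp [Fin.removeNth]

/-- The wedge product of two 1-forms, `(α ∧ β) (u, v) = α u * β v - α v * β u`. -/
def wedge (α β : OneForm) (p u v : Plane) : ℝ :=
  α p u * β p v - α p v * β p u

/-- `w₁, w₂` form a coframe on `U`: they are pointwise linearly independent. -/
def IsCoframe (U : Set Plane) (w₁ w₂ : OneForm) : Prop :=
  ∀ p ∈ U, LinearIndependent ℝ ![w₁ p, w₂ p]

/-- The differential of a function. -/
noncomputable def dFun (f : Plane → ℝ) : OneForm := fun p => fderiv ℝ f p

/-- The invariant differential operator `D¹` of a coframe, characterized by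
`df = (D¹ f) w₁ + (D² f) w₂`; here through `df ∧ w₂ = (D¹ f) w₁ ∧ w₂`. -/
noncomputable def D1 (w₁ w₂ : OneForm) (f : Plane → ℝ) (p : Plane) : ℝ :=
  wedge (dFun f) w₂ p (1, 0) (0, 1) / wedge w₁ w₂ p (1, 0) (0, 1)

/-- The invariant differential operator `D²` of a coframe, characterized by
`df = (D¹ f) w₁ + (D² f) w₂`; here through `w₁ ∧ df = (D² f) w₁ ∧ w₂`. -/
noncomputable def D2 (w₁ w₂ : OneForm) (f : Plane → ℝ) (p : Plane) : ℝ :=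
  wedge w₁ (dFun f) p (1, 0) (0, 1) / wedge w₁ w₂ p (1, 0) (0, 1)

/-- The defining property `df = (D¹ f) w₁ + (D² f) w₂` of the invariant differential operators. -/
theorem dFun_eq {U : Set Plane} {w₁ w₂ : OneForm} (h : IsCoframe U w₁ w₂) {p : Plane}
    (hp : p ∈ U) (f : Plane → ℝ) :
    dFun f p = D1 w₁ w₂ f p • w₁ p + D2 w₁ w₂ f p • w₂ p := by
  have key : ∀ (L : Plane →L[ℝ] ℝ) (v : Plane), L v = v.1 * L (1, 0) + v.2 * L (0, 1) := by
    intro L v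
    have : v = v.1 • ((1 : ℝ), (0 : ℝ)) + v.2 • ((0 : ℝ), (1 : ℝ)) := by ext <;> simp
    conv_lhs => rw [this]
    rw [map_add, map_smul, map_smul, smul_eq_mul, smul_eq_mul]
  have hW : wedge w₁ w₂ p (1, 0) (0, 1) ≠ 0 := by
    intro h0
    have hl := LinearIndependent.pair_iff.1 (h p hp)
    unfold wedge at h0
    have h1 := hl (w₂ p (1, 0)) (-w₁ p (1, 0)) (by
      ext <;> simp <;> linarith)
    have h2 := hl (w₂ p (0, 1)) (-w₁ p (0, 1)) (by
      ext <;> simp <;> linarith)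
    have hz : w₁ p = 0 := by
      ext <;> simp <;> [linarith [h1.2]; linarith [h2.2]]
    have := hl 1 0 (by simp [hz])
    simp at this
  refine ContinuousLinearMap.ext fun v => ?_
  simp only [D1, D2, add_apply, smul_apply, smul_eq_mul]
  rw [key (dFun f p) v, key (w₁ p) v, key (w₂ p) v]
  field_simp
  simp only [wedge]
  ring

/-! ### Surfaces, standard forms, moving frames and invariants -/

/-- The graph `z = u (x, y)`, in the affine coordinate system with origin `r p` and axes
`e 0, e 1, e 2`, is the surface parametrized by `r` near the point `r p`. -/
def IsLocalGraph (r : Plane → A3) (p : Plane) (e : Fin 3 → A3) (u : ℝ × ℝ → ℝ) : Prop :=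
  ContDiffAt ℝ ∞ u 0 ∧
    ∀ᶠ q in 𝓝 p, ∃ x y : ℝ, r q = r p + x • e 0 + y • e 1 + u (x, y) • e 2

/-- In the affine frame `e` at `r p` the surface has the standard third order jet
`z = (x² + y²) / 2 + (x³ - 3 x y²) / 6 + ⋯`. -/
def IsStandardFrameAt (r : Plane → A3) (p : Plane) (e : Fin 3 → A3) : Prop :=
  LinearIndependent ℝ e ∧ ∃ u : ℝ × ℝ → ℝ, IsLocalGraph r p e u ∧
    (fun s : ℝ × ℝ => u s - ((s.1 ^ 2 + s.2 ^ 2) / 2 + (s.1 ^ 3 - 3 * s.1 * s.2 ^ 2) / 6))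
      =o[𝓝 0] fun s => ‖s‖ ^ 3

/-- A regular elliptical surface, through a local parametrization `r : U → A³`: a smooth immersion
of an open set of the plane such that the jet at every point can be brought by an affine
transformation to the regular elliptical standard form. -/
structure IsRegularElliptical (U : Set Plane) (r : Plane → A3) : Prop where
  isOpen : IsOpen U
  smooth : ContDiffOn ℝ ∞ r U
  immersion : ∀ p ∈ U, Function.Injective (fderiv ℝ r p)
  regular : ∀ p ∈ U, ∃ e : Fin 3 → A3, IsStandardFrameAt r p e

/-- A moving frame of a regular elliptical surface: a smooth field of affine frames
`(e 0, e 1, e 2)` in which the jets of the surface have the standard form. -/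
structure IsMovingFrame (U : Set Plane) (r : Plane → A3) (e : Fin 3 → Plane → A3) : Prop where
  smooth : ∀ i, ContDiffOn ℝ ∞ (e i) U
  standard : ∀ p ∈ U, IsStandardFrameAt r p (fun i => e i p)

/-- The invariant 1-forms `w₁, w₂` of a moving frame, `dr = w₁ e₁ + w₂ e₂`. -/
def AreInvariantForms (U : Set Plane) (r : Plane → A3) (e : Fin 3 → Plane → A3)
    (w₁ w₂ : OneForm) : Prop :=
  ∀ p ∈ U, ∀ v, fderiv ℝ r p v = w₁ p v • e 0 p + w₂ p v • e 1 p

/-- Five functions on the parameter plane, in the role of the fundamental curvatures. -/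
structure Curvatures where
  (I40 I31 I22 I13 I04 : Plane → ℝ)

/-- The five functions are smooth on `U`. -/
def Curvatures.Smooth (K : Curvatures) (U : Set Plane) : Prop :=
  ContDiffOn ℝ ∞ K.I40 U ∧ ContDiffOn ℝ ∞ K.I31 U ∧ ContDiffOn ℝ ∞ K.I22 U ∧
    ContDiffOn ℝ ∞ K.I13 U ∧ ContDiffOn ℝ ∞ K.I04 U

/-- The fundamental curvatures of a moving frame: the fourth order Taylor coefficients of
`z = u (x, y)`, in `u = (x² + y²) / 2 + (x³ - 3 x y²) / 6
  + (I₄₀ x⁴ + 4 I₃₁ x³ y + 6 I₂₂ x² y² + 4 I₁₃ x y³ + I₀₄ y⁴) / 24 + ⋯`. -/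
def AreFundamentalCurvatures (U : Set Plane) (r : Plane → A3) (e : Fin 3 → Plane → A3)
    (K : Curvatures) : Prop :=
  ∀ p ∈ U, ∃ u : ℝ × ℝ → ℝ, IsLocalGraph r p (fun i => e i p) u ∧
    (fun s : ℝ × ℝ => u s - ((s.1 ^ 2 + s.2 ^ 2) / 2 + (s.1 ^ 3 - 3 * s.1 * s.2 ^ 2) / 6
      + (K.I40 p * s.1 ^ 4 + 4 * K.I31 p * s.1 ^ 3 * s.2 + 6 * K.I22 p * s.1 ^ 2 * s.2 ^ 2
        + 4 * K.I13 p * s.1 * s.2 ^ 3 + K.I04 p * s.2 ^ 4) / 24))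
      =o[𝓝 0] fun s => ‖s‖ ^ 4

/-! ### The matrix of the moving equation and the compatibility conditions -/

/-- The Maurer-Cartan invariants `R¹ᵢⱼ`, as polynomials in the curvatures. -/
noncomputable def R1 (K : Curvatures) (p : Plane) : Matrix (Fin 3) (Fin 3) ℝ :=
  !![-K.I40 p / 4 + 3 * K.I22 p / 4 - 1 / 2, -K.I31 p / 4 + K.I13 p / 12,
        -K.I40 p / 4 - K.I22 p / 4 + 1 / 2;
     K.I31 p / 4 - K.I13 p / 12, -K.I40 p / 4 + 3 * K.I22 p / 4 + 1 / 2,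
        -K.I31 p / 4 - K.I13 p / 4;
     1, 0, -K.I40 p / 2 + 3 * K.I22 p / 2]

/-- The Maurer-Cartan invariants `R²ᵢⱼ`, as polynomials in the curvatures. -/
noncomputable def R2 (K : Curvatures) (p : Plane) : Matrix (Fin 3) (Fin 3) ℝ :=
  !![-K.I31 p / 4 + 3 * K.I13 p / 4, -K.I22 p / 4 + K.I04 p / 12 + 1 / 2,
        -K.I31 p / 4 - K.I13 p / 4;
     K.I22 p / 4 - K.I04 p / 12 + 1 / 2, -K.I31 p / 4 + 3 * K.I13 p / 4,
        -K.I22 p / 4 - K.I04 p / 4 + 1 / 2;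
     0, 1, -K.I31 p / 2 + 3 * K.I13 p / 2]

/-- The 1-forms `wᵢⱼ = R¹ᵢⱼ w₁ + R²ᵢⱼ w₂`. -/
noncomputable def wForm (w₁ w₂ : OneForm) (K : Curvatures) (i j : Fin 3) : OneForm :=
  fun p => R1 K p i j • w₁ p + R2 K p i j • w₂ p

/-- The matrix `Ω` of 1-forms with blocks `(wᵢⱼ)`, the column `(w₁, w₂, 0)` and a zero row. -/
noncomputable def Omega (w₁ w₂ : OneForm) (K : Curvatures) : Matrix (Fin 4) (Fin 4) OneForm :=
  !![wForm w₁ w₂ K 0 0, wForm w₁ w₂ K 0 1, wForm w₁ w₂ K 0 2, w₁;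
     wForm w₁ w₂ K 1 0, wForm w₁ w₂ K 1 1, wForm w₁ w₂ K 1 2, w₂;
     wForm w₁ w₂ K 2 0, wForm w₁ w₂ K 2 1, wForm w₁ w₂ K 2 2, 0;
     0, 0, 0, 0]

/-- The moving equation `d(e₁, e₂, e₃, r) = (e₁, e₂, e₃, r) Ω`. -/
def MovingEquation (U : Set Plane) (r : Plane → A3) (e : Fin 3 → Plane → A3)
    (Ω : Matrix (Fin 4) (Fin 4) OneForm) : Prop :=
  ∀ p ∈ U, ∀ v, ∀ j : Fin 4,
    fderiv ℝ (![e 0, e 1, e 2, r] j) p v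
      = ∑ i : Fin 4, Ω i j p v • (![e 0, e 1, e 2, r] i) p

/-- Cartan's structure equation `dΩ + Ω ∧ Ω = 0` on `U`. -/
def StructureEquation (U : Set Plane) (Ω : Matrix (Fin 4) (Fin 4) OneForm) : Prop :=
  ∀ p ∈ U, ∀ u v, ∀ i j : Fin 4, d (Ω i j) p u v + ∑ k, wedge (Ω i k) (Ω k j) p u v = 0

/-- The invariant `Y₁`. -/
noncomputable def Y1 (K : Curvatures) (p : Plane) : ℝ := 2 * K.I13 p / 3

/-- The invariant `Y₂`. -/
noncomputable def Y2 (K : Curvatures) (p : Plane) : ℝ :=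
  K.I40 p / 4 - K.I22 p / 2 - K.I04 p / 12

/-- The six compatibility conditions on `U`. -/
structure CompatibilityConditions (U : Set Plane) (w₁ w₂ : OneForm) (K : Curvatures) : Prop where
  first : ∀ p ∈ U,
    36 * D2 w₁ w₂ K.I31 p - 36 * D1 w₁ w₂ K.I22 p - 12 * D2 w₁ w₂ K.I13 p
      + 12 * D1 w₁ w₂ K.I04 p - 9 * K.I40 p * K.I22 p + 3 * K.I40 p * K.I04 p
      - 24 * K.I31 p * K.I13 p + 18 * K.I22 p ^ 2 - 3 * K.I22 p * K.I04 p
      + 8 * K.I13 p ^ 2 - K.I04 p ^ 2 - 18 * K.I40 p - 36 * K.I22 p - 18 * K.I04 p = 0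
  second : ∀ p ∈ U,
    12 * D2 w₁ w₂ K.I40 p - 12 * D1 w₁ w₂ K.I31 p + 12 * D2 w₁ w₂ K.I22 p
      - 12 * D1 w₁ w₂ K.I13 p - 3 * K.I40 p * K.I31 p - 23 * K.I40 p * K.I13 p
      + 18 * K.I31 p * K.I22 p + 5 * K.I31 p * K.I04 p - 6 * K.I22 p * K.I13 p
      + K.I13 p * K.I04 p + 48 * K.I13 p = 0
  third : ∀ p ∈ U,
    12 * D2 w₁ w₂ K.I31 p - 12 * D1 w₁ w₂ K.I22 p + 12 * D2 w₁ w₂ K.I13 p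
      - 12 * D1 w₁ w₂ K.I04 p - 3 * K.I40 p * K.I22 p - 7 * K.I40 p * K.I04 p
      - 16 * K.I31 p * K.I13 p + 18 * K.I22 p ^ 2 + 15 * K.I22 p * K.I04 p
      - 16 * K.I13 p ^ 2 + K.I04 p ^ 2 + 18 * K.I40 p - 36 * K.I22 p - 6 * K.I04 p = 0
  fourth : ∀ p ∈ U,
    12 * D2 w₁ w₂ K.I40 p - 12 * D1 w₁ w₂ K.I31 p - 36 * D2 w₁ w₂ K.I22 p
      + 36 * D1 w₁ w₂ K.I13 p - 3 * K.I40 p * K.I31 p + K.I40 p * K.I13 p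
      + 6 * K.I31 p * K.I22 p + K.I31 p * K.I04 p + 6 * K.I22 p * K.I13 p
      - 3 * K.I13 p * K.I04 p = 0
  fifth : ∀ p ∈ U, ∀ u v, d w₁ p u v = Y1 K p * wedge w₁ w₂ p u v
  sixth : ∀ p ∈ U, ∀ u v, d w₂ p u v = Y2 K p * wedge w₁ w₂ p u v

end AffineSurface

namespace AffineSurface

/-! ### The structure equation and the compatibility conditions -/

section InvariantOperators

variable {w₁ w₂ : OneForm} {f g : Plane → ℝ} {p : Plane}

/-! Part (b) is linear algebra over a coframe. By `d_coframe` every entry of `dΩ + Ω ∧ Ω` is a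
multiple of `w₁ ∧ w₂`. The first two entries of the last column are the formulas for `dw₁` and
`dw₂`. Once these are substituted, each remaining entry is either zero identically or a constant
multiple of one of the four differential conditions. Since `w₁ ∧ w₂` does not vanish, it can be
cancelled.

For part (a), write the surface and its moving frame in the fixed frame at a point `p` (`FrameJet`).
The equation `z - Q(x, y)`, with `Q` the quartic jet, vanishes beyond order four along the surface.
Differentiating along the fields dual to `w₁, w₂` lowers the order of vanishing by one each time
(`smooth_isLittleO`). The derivatives are expressed by the differentials of `z - Q` on the moving
axes and the coefficients `A` of `de`. The second, third and fourth derivatives, read at `p`, give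
`coeff_two`, `coeff_cubic` and `coeff_quartic`.

The normalization holds at every point with the same quadratic and cubic coefficients. Hence the
relations found at one stage are identities on `U`, and can be substituted in the expansion before
the next differentiation. Together they are 18 linear equations for the 18 unknowns `A`, with
solution `R¹, R²` (`frameCoeff_eq`). This is the moving equation, and it also shows that the
curvatures are smooth. The symmetry of second derivatives then yields the structure equation
(`MovingEquation.structureEquation`), and part (b) turns it into the six conditions. -/

theorem D1_add (hf : DifferentiableAt ℝ f p) (hg : DifferentiableAt ℝ g p) :
    D1 w₁ w₂ (fun q => f q + g q) p = D1 w₁ w₂ f p + D1 w₁ w₂ g p := by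
  simp only [D1, wedge, dFun, fderiv_fun_add hf hg, add_apply]
  ring

theorem D2_add (hf : DifferentiableAt ℝ f p) (hg : DifferentiableAt ℝ g p) :
    D2 w₁ w₂ (fun q => f q + g q) p = D2 w₁ w₂ f p + D2 w₁ w₂ g p := by
  simp only [D2, wedge, dFun, fderiv_fun_add hf hg, add_apply]
  ring

theorem D1_sub (hf : DifferentiableAt ℝ f p) (hg : DifferentiableAt ℝ g p) :
    D1 w₁ w₂ (fun q => f q - g q) p = D1 w₁ w₂ f p - D1 w₁ w₂ g p := by
  simp only [D1, wedge, dFun, fderiv_fun_sub hf hg, sub_apply]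
  ring

theorem D2_sub (hf : DifferentiableAt ℝ f p) (hg : DifferentiableAt ℝ g p) :
    D2 w₁ w₂ (fun q => f q - g q) p = D2 w₁ w₂ f p - D2 w₁ w₂ g p := by
  simp only [D2, wedge, dFun, fderiv_fun_sub hf hg, sub_apply]
  ring

theorem D1_const_mul (c : ℝ) (hf : DifferentiableAt ℝ f p) :
    D1 w₁ w₂ (fun q => c * f q) p = c * D1 w₁ w₂ f p := by
  simp only [D1, wedge, dFun, fderiv_const_mul hf, smul_apply, smul_eq_mul]
  ring

theorem D2_const_mul (c : ℝ) (hf : DifferentiableAt ℝ f p) :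
    D2 w₁ w₂ (fun q => c * f q) p = c * D2 w₁ w₂ f p := by
  simp only [D2, wedge, dFun, fderiv_const_mul hf, smul_apply, smul_eq_mul]
  ring

theorem D1_div_const (c : ℝ) (hf : DifferentiableAt ℝ f p) :
    D1 w₁ w₂ (fun q => f q / c) p = D1 w₁ w₂ f p / c := by
  simp only [div_eq_inv_mul, D1_const_mul _ hf]

theorem D2_div_const (c : ℝ) (hf : DifferentiableAt ℝ f p) :
    D2 w₁ w₂ (fun q => f q / c) p = D2 w₁ w₂ f p / c := by
  simp only [div_eq_inv_mul, D2_const_mul _ hf]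

theorem D1_neg : D1 w₁ w₂ (fun q => -f q) p = -D1 w₁ w₂ f p := by
  simp only [D1, wedge, dFun, fderiv_fun_neg, neg_apply]
  ring

theorem D2_neg : D2 w₁ w₂ (fun q => -f q) p = -D2 w₁ w₂ f p := by
  simp only [D2, wedge, dFun, fderiv_fun_neg, neg_apply]
  ring

theorem D1_const (c : ℝ) : D1 w₁ w₂ (fun _ => c) p = 0 := by
  simp [D1, wedge, dFun]

theorem D2_const (c : ℝ) : D2 w₁ w₂ (fun _ => c) p = 0 := by
  simp [D2, wedge, dFun]

/-- The exterior derivative of a 1-form written in a coframe. -/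
theorem d_coframe {U : Set Plane} (h : IsCoframe U w₁ w₂) (hp : p ∈ U)
    (h₁ : DifferentiableAt ℝ w₁ p) (h₂ : DifferentiableAt ℝ w₂ p)
    (hf : DifferentiableAt ℝ f p) (hg : DifferentiableAt ℝ g p) (u v : Plane) :
    d (fun q => f q • w₁ q + g q • w₂ q) p u v
      = f p * d w₁ p u v + g p * d w₂ p u v
        + (D1 w₁ w₂ g p - D2 w₁ w₂ f p) * wedge w₁ w₂ p u v := by
  have hF : fderiv ℝ f p = D1 w₁ w₂ f p • w₁ p + D2 w₁ w₂ f p • w₂ p := dFun_eq h hp f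
  have hG : fderiv ℝ g p = D1 w₁ w₂ g p • w₁ p + D2 w₁ w₂ g p • w₂ p := dFun_eq h hp g
  rw [d_apply (α := fun q => f q • w₁ q + g q • w₂ q) ((hf.smul h₁).add (hg.smul h₂)),
    d_apply h₁, d_apply h₂,
    fderiv_fun_add (hf.fun_smul h₁) (hg.fun_smul h₂), fderiv_fun_smul hf h₁,
    fderiv_fun_smul hg h₂, hF, hG]
  simp only [add_apply, smul_apply, ContinuousLinearMap.smulRight_apply, smul_eq_mul, wedge]
  ring

/-- If the denominator vanished, division by zero would make `D1` and `D2` zero on every function,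
so by `dFun_eq` every differential at `p` would vanish. The linear function `w₁ p`, which is its own
differential, contradicts this. -/
theorem wedge_ne_zero {U : Set Plane} (h : IsCoframe U w₁ w₂) (hp : p ∈ U) :
    wedge w₁ w₂ p (1, 0) (0, 1) ≠ 0 := by
  intro h0
  have h1 : D1 w₁ w₂ (fun q => w₁ p q) p = 0 := by simp [D1, h0]
  have h2 : D2 w₁ w₂ (fun q => w₁ p q) p = 0 := by simp [D2, h0]
  have h3 := dFun_eq h hp (fun q => w₁ p q)
  rw [h1, h2] at h3
  have h4 : w₁ p = 0 := by simpa [dFun] using h3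
  exact (h p hp).ne_zero 0 (by simpa using h4)

end InvariantOperators

theorem d_zero (p u v : Plane) : d 0 p u v = 0 := by
  have : DifferentiableAt ℝ (0 : OneForm) p := differentiableAt_const _
  rw [d_apply this]
  simp

theorem structureEquation_iff_compatibilityConditions {U : Set Plane} {w₁ w₂ : OneForm}
    {K : Curvatures} (hU : IsOpen U) (hw₁ : ContDiffOn ℝ ∞ w₁ U) (hw₂ : ContDiffOn ℝ ∞ w₂ U)
    (h : IsCoframe U w₁ w₂) (hK : K.Smooth U) :
    StructureEquation U (Omega w₁ w₂ K) ↔ CompatibilityConditions U w₁ w₂ K := by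
  have diff : ∀ {E : Type} [NormedAddCommGroup E] [NormedSpace ℝ E] {f : Plane → E},
      ContDiffOn ℝ ∞ f U → ∀ p ∈ U, DifferentiableAt ℝ f p := fun hf p hp =>
    (hf.contDiffAt (hU.mem_nhds hp)).differentiableAt (by simp)
  obtain ⟨h40, h31, h22, h13, h04⟩ := hK
  -- The two matrices hold `D¹R²ᵢⱼ` and `D²R¹ᵢⱼ`; their difference is the coefficient of `w₁ ∧ w₂`
  -- coming from the derivatives of the coefficients in `wᵢⱼ`.
  have hd : ∀ p ∈ U, ∀ u v i j, d (wForm w₁ w₂ K i j) p u v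
      = R1 K p i j * d w₁ p u v + R2 K p i j * d w₂ p u v
        + ((!![-D1 w₁ w₂ K.I31 p / 4 + 3 * D1 w₁ w₂ K.I13 p / 4,
              -D1 w₁ w₂ K.I22 p / 4 + D1 w₁ w₂ K.I04 p / 12,
              -D1 w₁ w₂ K.I31 p / 4 - D1 w₁ w₂ K.I13 p / 4;
            D1 w₁ w₂ K.I22 p / 4 - D1 w₁ w₂ K.I04 p / 12,
              -D1 w₁ w₂ K.I31 p / 4 + 3 * D1 w₁ w₂ K.I13 p / 4,
              -D1 w₁ w₂ K.I22 p / 4 - D1 w₁ w₂ K.I04 p / 4;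
            0, 0, -D1 w₁ w₂ K.I31 p / 2 + 3 * D1 w₁ w₂ K.I13 p / 2] : Matrix (Fin 3) (Fin 3) ℝ)
          i j
          - (!![-D2 w₁ w₂ K.I40 p / 4 + 3 * D2 w₁ w₂ K.I22 p / 4,
              -D2 w₁ w₂ K.I31 p / 4 + D2 w₁ w₂ K.I13 p / 12,
              -D2 w₁ w₂ K.I40 p / 4 - D2 w₁ w₂ K.I22 p / 4;
            D2 w₁ w₂ K.I31 p / 4 - D2 w₁ w₂ K.I13 p / 12,
              -D2 w₁ w₂ K.I40 p / 4 + 3 * D2 w₁ w₂ K.I22 p / 4,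
              -D2 w₁ w₂ K.I31 p / 4 - D2 w₁ w₂ K.I13 p / 4;
            0, 0, -D2 w₁ w₂ K.I40 p / 2 + 3 * D2 w₁ w₂ K.I22 p / 2] : Matrix (Fin 3) (Fin 3) ℝ)
          i j) * wedge w₁ w₂ p u v := by
    intro p hp u v i j
    have d40 := diff h40 p hp
    have d31 := diff h31 p hp
    have d22 := diff h22 p hp
    have d13 := diff h13 p hp
    have d04 := diff h04 p hp
    have e1 : DifferentiableAt ℝ (fun q => R1 K q i j) p := by
      fin_cases i <;> fin_cases j <;> simp [R1] <;> fun_prop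
    have e2 : DifferentiableAt ℝ (fun q => R2 K q i j) p := by
      fin_cases i <;> fin_cases j <;> simp [R2] <;> fun_prop
    rw [show wForm w₁ w₂ K i j = fun q => R1 K q i j • w₁ q + R2 K q i j • w₂ q from rfl,
      d_coframe h hp (diff hw₁ p hp) (diff hw₂ p hp) e1 e2]
    congr 2
    clear e1 e2
    fin_cases i <;> fin_cases j <;>
      simp (disch := fun_prop) [R1, R2, D1_add, D1_sub, D1_const_mul, D1_div_const, D1_neg,
        D1_const, D2_add, D2_sub, D2_const_mul, D2_div_const, D2_neg, D2_const]
  constructor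
  · intro hS
    -- The last column involves no derivatives of the curvatures, so it yields `dw₁` and `dw₂`
    -- directly; the other entries need both.
    have fifth : ∀ p ∈ U, ∀ u v, d w₁ p u v = Y1 K p * wedge w₁ w₂ p u v := by
      intro p hp u v
      have E := hS p hp u v 0 3
      simp [Omega, Fin.sum_univ_four, wForm, wedge, R1, R2] at E
      simp only [Y1, wedge]
      linear_combination E
    have sixth : ∀ p ∈ U, ∀ u v, d w₂ p u v = Y2 K p * wedge w₁ w₂ p u v := by
      intro p hp u v
      have E := hS p hp u v 1 3
      simp [Omega, Fin.sum_univ_four, wForm, wedge, R1, R2] at E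
      simp only [Y2, wedge]
      linear_combination E
    -- Four entries suffice: `(0,1)`, `(0,2)`, `(1,2)` and `(0,0)` carry the first, second, third
    -- and fourth conditions. The factors 144 and 48 clear denominators.
    refine ⟨fun p hp => ?_, fun p hp => ?_, fun p hp => ?_, fun p hp => ?_, fifth, sixth⟩ <;>
      refine mul_right_cancel₀ (wedge_ne_zero h hp) ?_
    · have E := hS p hp (1, 0) (0, 1) 0 1
      simp [Omega, Fin.sum_univ_four, hd p hp, fifth p hp, sixth p hp, Y1, Y2] at E
      simp [wForm, wedge, R1, R2] at E
      simp only [wedge]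
      linear_combination 144 * E
    · have E := hS p hp (1, 0) (0, 1) 0 2
      simp [Omega, Fin.sum_univ_four, hd p hp, fifth p hp, sixth p hp, Y1, Y2] at E
      simp [wForm, wedge, R1, R2] at E
      simp only [wedge]
      linear_combination 48 * E
    · have E := hS p hp (1, 0) (0, 1) 1 2
      simp [Omega, Fin.sum_univ_four, hd p hp, fifth p hp, sixth p hp, Y1, Y2] at E
      simp [wForm, wedge, R1, R2] at E
      simp only [wedge]
      linear_combination 48 * E
    · have E := hS p hp (1, 0) (0, 1) 0 0
      simp [Omega, Fin.sum_univ_four, hd p hp, fifth p hp, sixth p hp, Y1, Y2] at E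
      simp [wForm, wedge, R1, R2] at E
      simp only [wedge]
      linear_combination 48 * E
  · rintro ⟨c1, c2, c3, c4, fifth, sixth⟩ p hp u v i j
    -- Conversely, the remaining entries repeat the first or fourth condition up to a factor, or
    -- vanish identically after substituting `dw₁` and `dw₂`.
    fin_cases i <;> fin_cases j <;>
      simp [Omega, Fin.sum_univ_four, hd p hp, fifth p hp, sixth p hp, d_zero, Y1, Y2]
    · simp [wForm, wedge, R1, R2]
      linear_combination (w₁ p u * w₂ p v - w₁ p v * w₂ p u) * (1 / 48 * c4 p hp)
    · simp [wForm, wedge, R1, R2]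
      linear_combination (w₁ p u * w₂ p v - w₁ p v * w₂ p u) * (1 / 144 * c1 p hp)
    · simp [wForm, wedge, R1, R2]
      linear_combination (w₁ p u * w₂ p v - w₁ p v * w₂ p u) * (1 / 48 * c2 p hp)
    · simp [wForm, wedge, R1, R2]
      ring
    · simp [wForm, wedge, R1, R2]
      linear_combination (w₁ p u * w₂ p v - w₁ p v * w₂ p u) * (-1 / 144 * c1 p hp)
    · simp [wForm, wedge, R1, R2]
      linear_combination (w₁ p u * w₂ p v - w₁ p v * w₂ p u) * (1 / 48 * c4 p hp)
    · simp [wForm, wedge, R1, R2]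
      linear_combination (w₁ p u * w₂ p v - w₁ p v * w₂ p u) * (1 / 48 * c3 p hp)
    · simp [wForm, wedge, R1, R2]
      ring
    · simp [wForm, wedge, R1, R2]
      ring
    · simp [wForm, wedge, R1, R2]
      ring
    · simp [wForm, wedge, R1, R2]
      linear_combination (w₁ p u * w₂ p v - w₁ p v * w₂ p u) * (1 / 24 * c4 p hp)
    · simp [wForm, wedge, R1, R2]
      ring
    all_goals simp [wedge]

/-! ### Orders of vanishing of smooth functions -/

section Vanishing

variable {E F : Type*} [NormedAddCommGroup E] [NormedAddCommGroup F] {f : E → F} {p : E}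

theorem isLittleO_norm_sub_pow_of_le {m n : ℕ} (hmn : m ≤ n)
    (h : f =o[𝓝 p] fun q => ‖q - p‖ ^ n) : f =o[𝓝 p] fun q => ‖q - p‖ ^ m := by
  refine h.trans_isBigO ?_
  have h0 : Tendsto (fun q : E => ‖q - p‖) (𝓝 p) (𝓝 0) := tendsto_norm_sub_self p
  refine IsBigO.of_bound 1 ?_
  filter_upwards [h0.eventually (gt_mem_nhds one_pos)] with q hq
  simp only [norm_pow, norm_norm, one_mul]
  exact pow_le_pow_of_le_one (norm_nonneg _) hq.le hmn

theorem apply_eq_zero_of_isLittleO {n : ℕ}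
    (h : f =o[𝓝 p] fun q => ‖q - p‖ ^ n) (hf : ContinuousAt f p) : f p = 0 :=
  tendsto_nhds_unique hf (by simpa using isLittleO_norm_sub_pow_of_le (Nat.zero_le n) h)

variable [NormedSpace ℝ E] [NormedSpace ℝ F]

theorem fderiv_eq_zero_of_isLittleO {n : ℕ} (h : f =o[𝓝 p] fun q => ‖q - p‖ ^ (n + 1))
    (hf : ContinuousAt f p) : fderiv ℝ f p = 0 := by
  have h0 := apply_eq_zero_of_isLittleO h hf
  have h1 := isLittleO_norm_sub_pow_of_le (m := 1) (by omega) h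
  refine HasFDerivAt.fderiv (HasFDerivAt.of_isLittleO ?_)
  simpa [h0] using h1

theorem eventually_differentiableAt (hf : ContDiffAt ℝ ∞ f p) :
    ∀ᶠ q in 𝓝 p, DifferentiableAt ℝ f q := by
  have h1 : ContDiffAt ℝ 1 f p := hf.of_le (by exact_mod_cast le_top)
  filter_upwards [h1.eventually (by simp)] with q hq using hq.differentiableAt (by simp)

/-- This is the mean value inequality on the closed ball around `p` through `x`, where the
derivative is at most a constant times `‖x - p‖ ^ n`. -/
theorem isBigO_pow_succ_of_fderiv {n : ℕ} (hf : ContDiffAt ℝ ∞ f p) (h0 : f p = 0)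
    (h : fderiv ℝ f =O[𝓝 p] fun q => ‖q - p‖ ^ n) : f =O[𝓝 p] fun q => ‖q - p‖ ^ (n + 1) := by
  obtain ⟨C, hC⟩ := h.bound
  obtain ⟨δ, hδ, H⟩ := Metric.eventually_nhds_iff_ball.1 (hC.and (eventually_differentiableAt hf))
  refine IsBigO.of_bound (max C 0) ?_
  filter_upwards [Metric.ball_mem_nhds p hδ] with x hx
  have hsub : Metric.closedBall p ‖x - p‖ ⊆ Metric.ball p δ := by
    rw [Metric.mem_ball, dist_eq_norm] at hx
    exact Metric.closedBall_subset_ball hx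
  have := (convex_closedBall p ‖x - p‖).norm_image_sub_le_of_norm_fderiv_le (f := f) (𝕜 := ℝ)
    (C := max C 0 * ‖x - p‖ ^ n) (x := p) (y := x) (fun y hy => (H y (hsub hy)).2)
    (fun y hy => ?_) (by simp) (by simp [dist_eq_norm])
  · simpa [h0, pow_succ, mul_assoc] using this
  · refine (H y (hsub hy)).1.trans ?_
    rw [Metric.mem_closedBall, dist_eq_norm] at hy
    simp only [norm_pow, norm_norm]
    gcongr
    exact le_max_left _ _

/-- This is an interpolation inequality of Landau type: a step of length `h` bounds `‖Df‖` by `2 sup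
‖f‖ / h + h sup ‖D²f‖`. At distance `r` from `p` the step is `h = ε r`; a small `ε` controls the
second term, and the little-o bound on `f` then controls the first. -/
theorem fderiv_isLittleO_of_fderiv_fderiv {n : ℕ} (hf : ContDiffAt ℝ ∞ f p)
    (h : f =o[𝓝 p] fun q => ‖q - p‖ ^ (n + 2))
    (h2 : fderiv ℝ (fderiv ℝ f) =O[𝓝 p] fun q => ‖q - p‖ ^ n) :
    fderiv ℝ f =o[𝓝 p] fun q => ‖q - p‖ ^ (n + 1) := by
  have hf' : ContDiffAt ℝ ∞ (fderiv ℝ f) p := hf.fderiv_right (by simp)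
  obtain ⟨C, hC0, hC⟩ := h2.exists_pos
  have hC := hC.bound
  rw [isLittleO_iff]
  intro c hc
  -- The bound on `C * 2 ^ n * ε` leaves half of `c` for the second derivative term, and `ε ≤ 1`
  -- keeps the step inside the ball of radius `2 r`. The constant `η` below makes the other term
  -- exactly the other half.
  obtain ⟨ε, hε, hε1, hεc⟩ : ∃ ε : ℝ, 0 < ε ∧ ε ≤ 1 ∧ C * 2 ^ n * ε ≤ c / 2 := by
    refine ⟨min 1 (c / 2 / (C * 2 ^ n)), by positivity, min_le_left _ _, ?_⟩
    calc _ ≤ C * 2 ^ n * (c / 2 / (C * 2 ^ n)) := by gcongr; exact min_le_right _ _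
      _ = c / 2 := by field_simp
  set η := c / 2 * ε / 2 ^ (n + 3) with hη
  have hη0 : 0 < η := by positivity
  obtain ⟨δ, hδ, H⟩ := Metric.eventually_nhds_iff_ball.1
    (((hC.and (eventually_differentiableAt hf)).and (eventually_differentiableAt hf')).and
      (h.bound hη0))
  filter_upwards [Metric.ball_mem_nhds p (half_pos hδ)] with x hx
  rcases eq_or_ne x p with rfl | hxp
  · rw [fderiv_eq_zero_of_isLittleO h hf.continuousAt]
    simp
  rw [Metric.mem_ball, dist_eq_norm] at hx
  set r := ‖x - p‖ with hr
  have hr0 : 0 < r := norm_pos_iff.2 (sub_ne_zero.2 hxp)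
  have hsub : Metric.closedBall p (2 * r) ⊆ Metric.ball p δ :=
    Metric.closedBall_subset_ball (by linarith)
  have hx2 : x ∈ Metric.closedBall p (2 * r) := by
    rw [Metric.mem_closedBall, dist_eq_norm]; linarith
  have fbound : ∀ y ∈ Metric.closedBall p (2 * r), ‖f y‖ ≤ η * (2 * r) ^ (n + 2) := by
    intro y hy
    refine (H y (hsub hy)).2.trans ?_
    rw [Metric.mem_closedBall, dist_eq_norm] at hy
    simp only [norm_pow, norm_norm]
    gcongr
  have Dlip : ∀ y ∈ Metric.closedBall p (2 * r),
      ‖fderiv ℝ f y - fderiv ℝ f x‖ ≤ C * (2 * r) ^ n * ‖y - x‖ := fun y hy =>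
    (convex_closedBall p (2 * r)).norm_image_sub_le_of_norm_fderiv_le (f := fderiv ℝ f) (𝕜 := ℝ)
      (fun z hz => (H z (hsub hz)).1.2)
      (fun z hz => by
        refine (H z (hsub hz)).1.1.1.trans ?_
        rw [Metric.mem_closedBall, dist_eq_norm] at hz
        simp only [norm_pow, norm_norm]
        gcongr) hx2 hy
  rw [norm_pow, norm_norm]
  refine ContinuousLinearMap.opNorm_le_of_unit_norm (by positivity) fun w hw => ?_
  have hball : Metric.closedBall x (ε * r) ⊆ Metric.closedBall p (2 * r) := by
    refine Metric.closedBall_subset_closedBall' ?_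
    rw [dist_eq_norm]
    nlinarith
  have hyx : ‖x + (ε * r) • w - x‖ = ε * r := by
    rw [add_sub_cancel_left, norm_smul, hw, mul_one, Real.norm_of_nonneg (by positivity)]
  have hy : x + (ε * r) • w ∈ Metric.closedBall x (ε * r) := by
    rw [Metric.mem_closedBall, dist_eq_norm, hyx]
  have key := (convex_closedBall x (ε * r)).norm_image_sub_le_of_norm_fderiv_le' (f := f) (𝕜 := ℝ)
    (φ := fderiv ℝ f x) (C := C * (2 * r) ^ n * (ε * r))
    (fun z hz => (H z (hsub (hball hz))).1.1.2)
    (fun z hz => (Dlip z (hball hz)).trans (by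
      rw [Metric.mem_closedBall, dist_eq_norm] at hz
      gcongr)) (Metric.mem_closedBall_self (by positivity)) hy
  rw [hyx, add_sub_cancel_left, map_smul] at key
  have h3 : ‖(ε * r) • fderiv ℝ f x w‖ ≤ 2 * (η * (2 * r) ^ (n + 2))
      + C * (2 * r) ^ n * (ε * r) * (ε * r) := by
    have e : (ε * r) • fderiv ℝ f x w = f (x + (ε * r) • w) - f x
        - (f (x + (ε * r) • w) - f x - (ε * r) • fderiv ℝ f x w) := by abel
    rw [e]
    refine (norm_sub_le _ _).trans ((add_le_add (norm_sub_le _ _) key).trans ?_)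
    linarith [fbound _ (hball hy), fbound _ hx2]
  rw [norm_smul, Real.norm_of_nonneg (by positivity)] at h3
  have h4 : 2 * (η * (2 * r) ^ (n + 2)) + C * (2 * r) ^ n * (ε * r) * (ε * r)
      ≤ (ε * r) * (c * r ^ (n + 1)) := by
    have e1 : 2 * (η * (2 * r) ^ (n + 2)) = (ε * r) * (c / 2 * r ^ (n + 1)) := by
      rw [hη]; field_simp; ring
    have e2 : C * (2 * r) ^ n * (ε * r) * (ε * r) = (ε * r) * ((C * 2 ^ n * ε) * r ^ (n + 1)) := by
      ring
    have e3 : (C * 2 ^ n * ε) * r ^ (n + 1) ≤ c / 2 * r ^ (n + 1) := by gcongr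
    have e4 : 0 < ε * r := by positivity
    rw [e1, e2]
    nlinarith
  exact le_of_mul_le_mul_left (h3.trans h4) (by positivity)

end Vanishing

universe v

/-- A smooth function vanishing beyond order `n` vanishes to order `n + 1`, and differentiation
lowers the order of vanishing by one. -/
theorem smooth_isLittleO {E : Type v} [NormedAddCommGroup E] [NormedSpace ℝ E] {p : E} (n : ℕ) :
    (∀ {F : Type v} [NormedAddCommGroup F] [NormedSpace ℝ F] {f : E → F}, ContDiffAt ℝ ∞ f p →
      (f =o[𝓝 p] fun q => ‖q - p‖ ^ n) → f =O[𝓝 p] fun q => ‖q - p‖ ^ (n + 1)) ∧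
    (∀ {F : Type v} [NormedAddCommGroup F] [NormedSpace ℝ F] {f : E → F}, ContDiffAt ℝ ∞ f p →
      (f =o[𝓝 p] fun q => ‖q - p‖ ^ (n + 1)) → fderiv ℝ f =o[𝓝 p] fun q => ‖q - p‖ ^ n) := by
  -- The two claims are proved together: little-o for `f` passes to `fderiv ℝ f`, is improved there
  -- to big-O one order higher, and is integrated back. The codomain changes to `E →L[ℝ] F`, hence
  -- the quantification over `F` inside the induction and the common universe.
  have step : ∀ k : ℕ,
    (∀ {F : Type v} [NormedAddCommGroup F] [NormedSpace ℝ F] {f : E → F}, ContDiffAt ℝ ∞ f p →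
      (f =o[𝓝 p] fun q => ‖q - p‖ ^ (k + 1)) → fderiv ℝ f =o[𝓝 p] fun q => ‖q - p‖ ^ k) →
    (∀ {F : Type v} [NormedAddCommGroup F] [NormedSpace ℝ F] {f : E → F}, ContDiffAt ℝ ∞ f p →
      (f =o[𝓝 p] fun q => ‖q - p‖ ^ k) → f =O[𝓝 p] fun q => ‖q - p‖ ^ (k + 1)) →
    ∀ {F : Type v} [NormedAddCommGroup F] [NormedSpace ℝ F] {f : E → F}, ContDiffAt ℝ ∞ f p →
      (f =o[𝓝 p] fun q => ‖q - p‖ ^ (k + 1)) → f =O[𝓝 p] fun q => ‖q - p‖ ^ (k + 2) :=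
    fun k hA hB {F} _ _ f hf h => isBigO_pow_succ_of_fderiv hf
      (apply_eq_zero_of_isLittleO h hf.continuousAt)
      (hB (hf.fderiv_right (by simp)) (hA hf h))
  induction n using Nat.strong_induction_on with
  | _ n ih =>
    match n, ih with
    | 0, _ =>
      constructor
      · intro F _ _ f hf h
        have h0 := apply_eq_zero_of_isLittleO h hf.continuousAt
        have := (hf.differentiableAt (by simp)).isBigO_sub
        simpa [h0] using this.norm_right
      · intro F _ _ f hf h
        have h0 := fderiv_eq_zero_of_isLittleO h hf.continuousAt
        have hf' : ContDiffAt ℝ ∞ (fderiv ℝ f) p := hf.fderiv_right (by simp)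
        have := hf'.continuousAt.tendsto
        rw [h0] at this
        simpa using this
    | 1, ih =>
      refine ⟨step 0 (ih 0 (by omega)).2 (ih 0 (by omega)).1, ?_⟩
      intro F _ _ f hf h
      have hf'' : ContDiffAt ℝ ∞ (fderiv ℝ (fderiv ℝ f)) p :=
        ContDiffAt.fderiv_right (hf.fderiv_right (m := ∞) (by simp)) (by simp)
      refine fderiv_isLittleO_of_fderiv_fderiv (n := 0) hf h ?_
      simpa using hf''.continuousAt.tendsto.isBigO_one ℝ
    | n + 2, ih =>
      refine ⟨step (n + 1) (ih (n + 1) (by omega)).2 (ih (n + 1) (by omega)).1, ?_⟩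
      intro F _ _ f hf h
      have hf' : ContDiffAt ℝ ∞ (fderiv ℝ f) p := hf.fderiv_right (by simp)
      -- Two lower cases show that the second derivative is little-o of order `n`; smoothness
      -- improves this to big-O of order `n + 1`, as the interpolation requires.
      refine fderiv_isLittleO_of_fderiv_fderiv (n := n + 1) hf h ?_
      refine (ih n (by omega)).1 (hf'.fderiv_right (by simp)) ((ih n (by omega)).2 hf' ?_)
      exact (ih (n + 1) (by omega)).2 hf (isLittleO_norm_sub_pow_of_le (by omega) h)

/-! ### Derivatives along a vector field -/

/-- The smooth function `f` has the derivative `f'` along the vector field `Y` on `U`. -/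
structure HasDerivAlong (U : Set Plane) (Y : Plane → Plane) (f f' : Plane → ℝ) : Prop where
  smooth : ContDiffOn ℝ ∞ f U
  eq : ∀ q ∈ U, fderiv ℝ f q (Y q) = f' q

namespace HasDerivAlong

variable {U : Set Plane} {Y : Plane → Plane} {f f' g g' : Plane → ℝ} {p : Plane}

theorem differentiableAt (hf : HasDerivAlong U Y f f') (hU : IsOpen U) (hp : p ∈ U) :
    DifferentiableAt ℝ f p :=
  (hf.smooth.contDiffAt (hU.mem_nhds hp)).differentiableAt (by simp)

theorem continuousAt (hf : HasDerivAlong U Y f f') (hU : IsOpen U) (hp : p ∈ U) :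
    ContinuousAt f p :=
  (hf.differentiableAt hU hp).continuousAt

theorem congr (hf : HasDerivAlong U Y f f') (h : ∀ q ∈ U, f' q = g' q) :
    HasDerivAlong U Y f g' :=
  ⟨hf.smooth, fun q hq => (hf.eq q hq).trans (h q hq)⟩

theorem const (c : ℝ) : HasDerivAlong U Y (fun _ => c) fun _ => 0 :=
  ⟨contDiffOn_const, fun q _ => by simp⟩

theorem add (hU : IsOpen U) (hf : HasDerivAlong U Y f f') (hg : HasDerivAlong U Y g g') :
    HasDerivAlong U Y (fun q => f q + g q) fun q => f' q + g' q :=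
  ⟨hf.smooth.add hg.smooth, fun q hq => by
    rw [fderiv_fun_add (hf.differentiableAt hU hq) (hg.differentiableAt hU hq), add_apply,
      hf.eq q hq, hg.eq q hq]⟩

theorem sub (hU : IsOpen U) (hf : HasDerivAlong U Y f f') (hg : HasDerivAlong U Y g g') :
    HasDerivAlong U Y (fun q => f q - g q) fun q => f' q - g' q :=
  ⟨hf.smooth.sub hg.smooth, fun q hq => by
    rw [fderiv_fun_sub (hf.differentiableAt hU hq) (hg.differentiableAt hU hq), sub_apply,
      hf.eq q hq, hg.eq q hq]⟩

theorem mul (hU : IsOpen U) (hf : HasDerivAlong U Y f f') (hg : HasDerivAlong U Y g g') :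
    HasDerivAlong U Y (fun q => f q * g q) fun q => f' q * g q + f q * g' q :=
  ⟨hf.smooth.mul hg.smooth, fun q hq => by
    rw [fderiv_fun_mul (hf.differentiableAt hU hq) (hg.differentiableAt hU hq), add_apply,
      smul_apply, smul_apply, hf.eq q hq, hg.eq q hq, smul_eq_mul, smul_eq_mul]
    ring⟩

theorem const_mul (hU : IsOpen U) (c : ℝ) (hf : HasDerivAlong U Y f f') :
    HasDerivAlong U Y (fun q => c * f q) fun q => c * f' q :=
  ((const c).mul hU hf).congr fun q _ => by ring

/-- Differentiation along a vector field lowers the order of vanishing by one. -/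
theorem isLittleO (hf : HasDerivAlong U Y f f') (hU : IsOpen U) (hp : p ∈ U)
    (hY : ContinuousAt Y p) {n : ℕ} (h : f =o[𝓝 p] fun q => ‖q - p‖ ^ (n + 1)) :
    f' =o[𝓝 p] fun q => ‖q - p‖ ^ n := by
  have h1 := (smooth_isLittleO n).2 (hf.smooth.contDiffAt (hU.mem_nhds hp)) h
  have h2 : (fun q => fderiv ℝ f q (Y q)) =o[𝓝 p] fun q => ‖q - p‖ ^ n := by
    have h3 : (fun q => ‖fderiv ℝ f q‖ * ‖Y q‖) =o[𝓝 p] fun q => ‖q - p‖ ^ n * (1 : ℝ) :=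
      h1.norm_left.mul_isBigO (hY.norm.tendsto.isBigO_one ℝ)
    simp only [mul_one] at h3
    exact (IsBigO.of_bound 1 (Eventually.of_forall fun q => by
      simpa using (fderiv ℝ f q).le_opNorm (Y q))).trans_isLittleO h3
  refine h2.congr' ?_ EventuallyEq.rfl
  filter_upwards [hU.mem_nhds hp] with q hq using hf.eq q hq

end HasDerivAlong

theorem mul_isLittleO {f g : Plane → ℝ} {p : Plane} {n : ℕ} (hf : ContinuousAt f p)
    (hg : g =o[𝓝 p] fun q => ‖q - p‖ ^ n) : (fun q => f q * g q) =o[𝓝 p] fun q => ‖q - p‖ ^ n := by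
  simpa using (hf.tendsto.isBigO_one ℝ).mul_isLittleO hg

/-! ### The quartic jet of a surface in a moving frame -/

section Jets

/-- The partial derivatives of order `3` of a polynomial with the third order coefficients `c` and
the fourth order coefficients `I`, indexed by the order of differentiation in `y`. -/
def jet3 (c I : ℕ → ℝ) (n : ℕ) (x y : ℝ) : ℝ := c n + (I n * x + I (n + 1) * y)

/-- The partial derivatives of order `2` of a quartic polynomial. -/
noncomputable def jet2 (g c I : ℕ → ℝ) (n : ℕ) (x y : ℝ) : ℝ :=
  g n + (c n * x + c (n + 1) * y)
    + (I n / 2 * (x * x) + I (n + 1) * (x * y) + I (n + 2) / 2 * (y * y))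

/-- The partial derivatives of order `1` of a quartic polynomial. -/
noncomputable def jet1 (g c I : ℕ → ℝ) (n : ℕ) (x y : ℝ) : ℝ :=
  (g n * x + g (n + 1) * y)
    + (c n / 2 * (x * x) + c (n + 1) * (x * y) + c (n + 2) / 2 * (y * y))
    + (I n / 6 * (x * (x * x)) + I (n + 1) / 2 * (x * (x * y)) + I (n + 2) / 2 * (x * (y * y))
      + I (n + 3) / 6 * (y * (y * y)))

/-- The polynomial with the coefficients `g`, `c`, `I` of order two, three and four. -/
noncomputable def jet0 (g c I : ℕ → ℝ) (x y : ℝ) : ℝ :=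
  (g 0 / 2 * (x * x) + g 1 * (x * y) + g 2 / 2 * (y * y))
    + (c 0 / 6 * (x * (x * x)) + c 1 / 2 * (x * (x * y)) + c 2 / 2 * (x * (y * y))
      + c 3 / 6 * (y * (y * y)))
    + (I 0 / 24 * ((x * x) * (x * x)) + I 1 / 6 * ((x * x) * (x * y))
      + I 2 / 4 * ((x * x) * (y * y)) + I 3 / 6 * ((x * y) * (y * y))
      + I 4 / 24 * ((y * y) * (y * y)))

variable (g c I : ℕ → ℝ) {U : Set Plane} {Y : Plane → Plane} {x x' y y' : Plane → ℝ}

theorem hasDerivAlong_jet0 (hU : IsOpen U) (hx : HasDerivAlong U Y x x')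
    (hy : HasDerivAlong U Y y y') :
    HasDerivAlong U Y (fun q => jet0 g c I (x q) (y q))
      fun q => jet1 g c I 0 (x q) (y q) * x' q + jet1 g c I 1 (x q) (y q) * y' q := by
  have xx := hx.mul hU hx
  have xy := hx.mul hU hy
  have yy := hy.mul hU hy
  refine HasDerivAlong.congr ((((xx.const_mul hU (g 0 / 2)).add hU (xy.const_mul hU (g 1))).add hU
      (yy.const_mul hU (g 2 / 2))).add hU
    (((((hx.mul hU xx).const_mul hU (c 0 / 6)).add hU ((hx.mul hU xy).const_mul hU (c 1 / 2))).add
      hU ((hx.mul hU yy).const_mul hU (c 2 / 2))).add hU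
      ((hy.mul hU yy).const_mul hU (c 3 / 6))) |>.add hU
    ((((((xx.mul hU xx).const_mul hU (I 0 / 24)).add hU ((xx.mul hU xy).const_mul hU (I 1 / 6))).add
      hU ((xx.mul hU yy).const_mul hU (I 2 / 4))).add hU
      ((xy.mul hU yy).const_mul hU (I 3 / 6))).add hU
      ((yy.mul hU yy).const_mul hU (I 4 / 24)))) fun q _ => ?_
  simp only [jet1]
  ring

theorem hasDerivAlong_jet1 (hU : IsOpen U) (hx : HasDerivAlong U Y x x')
    (hy : HasDerivAlong U Y y y') (n : ℕ) :
    HasDerivAlong U Y (fun q => jet1 g c I n (x q) (y q))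
      fun q => jet2 g c I n (x q) (y q) * x' q + jet2 g c I (n + 1) (x q) (y q) * y' q := by
  have xx := hx.mul hU hx
  have xy := hx.mul hU hy
  have yy := hy.mul hU hy
  refine HasDerivAlong.congr (((hx.const_mul hU (g n)).add hU (hy.const_mul hU (g (n + 1)))).add hU
    (((xx.const_mul hU (c n / 2)).add hU (xy.const_mul hU (c (n + 1)))).add hU
      (yy.const_mul hU (c (n + 2) / 2))) |>.add hU
    (((((hx.mul hU xx).const_mul hU (I n / 6)).add hU
      ((hx.mul hU xy).const_mul hU (I (n + 1) / 2))).add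
      hU ((hx.mul hU yy).const_mul hU (I (n + 2) / 2))).add hU
      ((hy.mul hU yy).const_mul hU (I (n + 3) / 6)))) fun q _ => ?_
  simp only [jet2]
  ring

theorem hasDerivAlong_jet2 (hU : IsOpen U) (hx : HasDerivAlong U Y x x')
    (hy : HasDerivAlong U Y y y') (n : ℕ) :
    HasDerivAlong U Y (fun q => jet2 g c I n (x q) (y q))
      fun q => jet3 c I n (x q) (y q) * x' q + jet3 c I (n + 1) (x q) (y q) * y' q := by
  have xx := hx.mul hU hx
  have xy := hx.mul hU hy
  have yy := hy.mul hU hy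
  refine HasDerivAlong.congr (((HasDerivAlong.const (g n)).add hU ((hx.const_mul hU (c n)).add hU
    (hy.const_mul hU (c (n + 1))))).add hU
    (((xx.const_mul hU (I n / 2)).add hU (xy.const_mul hU (I (n + 1)))).add hU
      (yy.const_mul hU (I (n + 2) / 2)))) fun q _ => ?_
  simp only [jet3]
  ring

theorem hasDerivAlong_jet3 (hU : IsOpen U) (hx : HasDerivAlong U Y x x')
    (hy : HasDerivAlong U Y y y') (n : ℕ) :
    HasDerivAlong U Y (fun q => jet3 c I n (x q) (y q)) fun q => I n * x' q + I (n + 1) * y' q :=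
  HasDerivAlong.congr ((HasDerivAlong.const (c n)).add hU ((hx.const_mul hU (I n)).add hU
    (hy.const_mul hU (I (n + 1))))) fun q _ => by ring

end Jets

/-- The coordinates `ξ` of a surface and `a` of its moving frame, in the frame at the point `p`,
where the surface has the quartic jet with the coefficients `g`, `c`, `I`. The coefficients of the
derivatives of the frame along the vector fields `X 0`, `X 1` dual to the invariant forms
are `A 0`, `A 1`. -/
structure FrameJet (U : Set Plane) (p : Plane) (X : Fin 2 → Plane → Plane)
    (A : Fin 2 → Fin 3 → Fin 3 → Plane → ℝ) (g c I : ℕ → ℝ) (ξ : Fin 3 → Plane → ℝ)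
    (a : Fin 3 → Fin 3 → Plane → ℝ) : Prop where
  isOpen : IsOpen U
  mem : p ∈ U
  continuousAt_field : ∀ k, ContinuousAt (X k) p
  continuousAt_coeff : ∀ k s m, ContinuousAt (A k s m) p
  deriv_position : ∀ k i, HasDerivAlong U (X k) (ξ i) (a i k.castSucc)
  deriv_frame : ∀ k i m, HasDerivAlong U (X k) (a i m) fun q => ∑ s, A k s m q * a i s q
  position_apply : ∀ i, ξ i p = 0
  frame_apply : ∀ i m, a i m p = if i = m then 1 else 0
  jet : (fun q => ξ 2 q - jet0 g c I (ξ 0 q) (ξ 1 q)) =o[𝓝 p] fun q => ‖q - p‖ ^ 4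

/-! ### Differentials of the quartic on the moving axes -/

section FrameJet

variable (g c I : ℕ → ℝ) (ξ : Fin 3 → Plane → ℝ) (a : Fin 3 → Fin 3 → Plane → ℝ)

/-- The value on the `m`-th axis of the differential of the equation of the quartic. -/
noncomputable def conormal (m : Fin 3) (q : Plane) : ℝ :=
  a 2 m q - (jet1 g c I 0 (ξ 0 q) (ξ 1 q) * a 0 m q + jet1 g c I 1 (ξ 0 q) (ξ 1 q) * a 1 m q)

/-- The second differential of the quartic polynomial, evaluated on two axes. -/
noncomputable def hess (m n : Fin 3) (q : Plane) : ℝ :=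
  jet2 g c I 0 (ξ 0 q) (ξ 1 q) * (a 0 m q * a 0 n q)
    + jet2 g c I 1 (ξ 0 q) (ξ 1 q) * (a 0 m q * a 1 n q + a 1 m q * a 0 n q)
    + jet2 g c I 2 (ξ 0 q) (ξ 1 q) * (a 1 m q * a 1 n q)

/-- The third differential of the quartic polynomial, evaluated on three axes. -/
noncomputable def cubic (m n s : Fin 3) (q : Plane) : ℝ :=
  jet3 c I 0 (ξ 0 q) (ξ 1 q) * (a 0 m q * (a 0 n q * a 0 s q))
    + jet3 c I 1 (ξ 0 q) (ξ 1 q) * (a 0 m q * (a 0 n q * a 1 s q) + a 0 m q * (a 1 n q * a 0 s q)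
      + a 1 m q * (a 0 n q * a 0 s q))
    + jet3 c I 2 (ξ 0 q) (ξ 1 q) * (a 0 m q * (a 1 n q * a 1 s q) + a 1 m q * (a 0 n q * a 1 s q)
      + a 1 m q * (a 1 n q * a 0 s q))
    + jet3 c I 3 (ξ 0 q) (ξ 1 q) * (a 1 m q * (a 1 n q * a 1 s q))

/-- The fourth differential of the quartic polynomial, evaluated on four axes. -/
def quartic (m n s t : Fin 3) (q : Plane) : ℝ :=
  I 0 * (a 0 m q * a 0 n q * a 0 s q * a 0 t q)
    + I 1 * (a 0 m q * a 0 n q * a 0 s q * a 1 t q + a 0 m q * a 0 n q * a 1 s q * a 0 t q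
      + a 0 m q * a 1 n q * a 0 s q * a 0 t q + a 1 m q * a 0 n q * a 0 s q * a 0 t q)
    + I 2 * (a 0 m q * a 0 n q * a 1 s q * a 1 t q + a 0 m q * a 1 n q * a 0 s q * a 1 t q
      + a 0 m q * a 1 n q * a 1 s q * a 0 t q + a 1 m q * a 0 n q * a 0 s q * a 1 t q
      + a 1 m q * a 0 n q * a 1 s q * a 0 t q + a 1 m q * a 1 n q * a 0 s q * a 0 t q)
    + I 3 * (a 0 m q * a 1 n q * a 1 s q * a 1 t q + a 1 m q * a 0 n q * a 1 s q * a 1 t q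
      + a 1 m q * a 1 n q * a 0 s q * a 1 t q + a 1 m q * a 1 n q * a 1 s q * a 0 t q)
    + I 4 * (a 1 m q * a 1 n q * a 1 s q * a 1 t q)

end FrameJet

/-! ### Their derivatives along the dual fields and their values at the base point -/

namespace FrameJet

variable {U : Set Plane} {p : Plane} {X : Fin 2 → Plane → Plane}
    {A : Fin 2 → Fin 3 → Fin 3 → Plane → ℝ} {g c I : ℕ → ℝ} {ξ : Fin 3 → Plane → ℝ}
    {a : Fin 3 → Fin 3 → Plane → ℝ}

section Derivatives

theorem deriv_equation (h : FrameJet U p X A g c I ξ a) (k : Fin 2) :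
    HasDerivAlong U (X k) (fun q => ξ 2 q - jet0 g c I (ξ 0 q) (ξ 1 q))
      (conormal g c I ξ a k.castSucc) :=
  (h.deriv_position k 2).sub h.isOpen
    (hasDerivAlong_jet0 g c I h.isOpen (h.deriv_position k 0) (h.deriv_position k 1))

/-- The derivative of the axis reproduces conormals with coefficients `A`; the derivative of the
base point contributes the second differential. `deriv_hess` and `deriv_cubic` follow the same
pattern one and two orders higher. -/
theorem deriv_conormal (h : FrameJet U p X A g c I ξ a) (k : Fin 2) (m : Fin 3) :
    HasDerivAlong U (X k) (conormal g c I ξ a m) fun q =>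
      (∑ s, A k s m q * conormal g c I ξ a s q) - hess g c I ξ a m k.castSucc q := by
  have j := hasDerivAlong_jet1 g c I h.isOpen (h.deriv_position k 0) (h.deriv_position k 1)
  refine HasDerivAlong.congr ((h.deriv_frame k 2 m).sub h.isOpen
    (((j 0).mul h.isOpen (h.deriv_frame k 0 m)).add h.isOpen
      ((j 1).mul h.isOpen (h.deriv_frame k 1 m)))) fun q _ => ?_
  simp only [Fin.sum_univ_three, conormal, hess, zero_add, Nat.reduceAdd]
  ring

theorem deriv_hess (h : FrameJet U p X A g c I ξ a) (k : Fin 2) (m n : Fin 3) :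
    HasDerivAlong U (X k) (hess g c I ξ a m n) fun q =>
      cubic c I ξ a m n k.castSucc q + (∑ s, A k s m q * hess g c I ξ a s n q)
        + ∑ s, A k s n q * hess g c I ξ a m s q := by
  have hU := h.isOpen
  have j := hasDerivAlong_jet2 g c I hU (h.deriv_position k 0) (h.deriv_position k 1)
  have b := h.deriv_frame k
  refine HasDerivAlong.congr ((((j 0).mul hU ((b 0 m).mul hU (b 0 n))).add hU
    ((j 1).mul hU (((b 0 m).mul hU (b 1 n)).add hU ((b 1 m).mul hU (b 0 n))))).add hU
    ((j 2).mul hU ((b 1 m).mul hU (b 1 n)))) fun q _ => ?_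
  simp only [Fin.sum_univ_three, hess, cubic, zero_add, Nat.reduceAdd]
  ring

theorem deriv_cubic (h : FrameJet U p X A g c I ξ a) (k : Fin 2) (m n t : Fin 3) :
    HasDerivAlong U (X k) (cubic c I ξ a m n t) fun q =>
      quartic I a m n t k.castSucc q + (∑ s, A k s m q * cubic c I ξ a s n t q)
        + (∑ s, A k s n q * cubic c I ξ a m s t q) + ∑ s, A k s t q * cubic c I ξ a m n s q := by
  have hU := h.isOpen
  have j := hasDerivAlong_jet3 c I hU (h.deriv_position k 0) (h.deriv_position k 1)
  have b := fun i i' i'' => (h.deriv_frame k i m).mul hU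
    ((h.deriv_frame k i' n).mul hU (h.deriv_frame k i'' t))
  refine HasDerivAlong.congr (((((j 0).mul hU (b 0 0 0)).add hU
    ((j 1).mul hU (((b 0 0 1).add hU (b 0 1 0)).add hU (b 1 0 0)))).add hU
    ((j 2).mul hU (((b 0 1 1).add hU (b 1 0 1)).add hU (b 1 1 0)))).add hU
    ((j 3).mul hU (b 1 1 1))) fun q _ => ?_
  simp only [Fin.sum_univ_three, cubic, quartic, zero_add, Nat.reduceAdd]
  ring

end Derivatives

section Values

theorem conormal_apply (h : FrameJet U p X A g c I ξ a) (m : Fin 3) :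
    conormal g c I ξ a m p = if m = 2 then 1 else 0 := by
  fin_cases m <;> simp [conormal, h.frame_apply, h.position_apply, jet1]

/-- At `p` the moving axes are the coordinate axes. The indices are added in `ℕ`, so that the sum
counts the differentiations in `y`. -/
theorem hess_apply (h : FrameJet U p X A g c I ξ a) (i j : Fin 2) :
    hess g c I ξ a i.castSucc j.castSucc p = g (i + j) := by
  fin_cases i <;> fin_cases j <;> simp [hess, h.frame_apply, h.position_apply, jet2]

theorem hess_apply_two_left (h : FrameJet U p X A g c I ξ a) (m : Fin 3) :
    hess g c I ξ a 2 m p = 0 := by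
  simp [hess, h.frame_apply]

theorem hess_apply_two_right (h : FrameJet U p X A g c I ξ a) (m : Fin 3) :
    hess g c I ξ a m 2 p = 0 := by
  simp [hess, h.frame_apply]

theorem cubic_apply (h : FrameJet U p X A g c I ξ a) (i j k : Fin 2) :
    cubic c I ξ a i.castSucc j.castSucc k.castSucc p = c (i + j + k) := by
  fin_cases i <;> fin_cases j <;> fin_cases k <;>
    simp [cubic, h.frame_apply, h.position_apply, jet3]

theorem quartic_apply (h : FrameJet U p X A g c I ξ a) (i j k l : Fin 2) :
    quartic I a i.castSucc j.castSucc k.castSucc l.castSucc p = I (i + j + k + l) := by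
  fin_cases i <;> fin_cases j <;> fin_cases k <;> fin_cases l <;>
    simp [quartic, h.frame_apply]

end Values

end FrameJet

theorem HasDerivAlong.apply_eq_zero {U : Set Plane} {Y : Plane → Plane} {f f' : Plane → ℝ}
    {p : Plane} (hf : HasDerivAlong U Y f f') (hU : IsOpen U) (hp : p ∈ U) {n : ℕ}
    (h : f =o[𝓝 p] fun q => ‖q - p‖ ^ (n + 1)) : f' p = 0 := by
  rw [← hf.eq p hp, fderiv_eq_zero_of_isLittleO h (hf.continuousAt hU hp), zero_apply]

/-! ### Orders of vanishing and the relations they impose on the frame coefficients -/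

namespace FrameJet

variable {U : Set Plane} {p : Plane} {X : Fin 2 → Plane → Plane}
    {A : Fin 2 → Fin 3 → Fin 3 → Plane → ℝ} {g c I : ℕ → ℝ} {ξ : Fin 3 → Plane → ℝ}
    {a : Fin 3 → Fin 3 → Plane → ℝ}

theorem conormal_isLittleO (h : FrameJet U p X A g c I ξ a) (i : Fin 2) :
    conormal g c I ξ a i.castSucc =o[𝓝 p] fun q => ‖q - p‖ ^ 3 :=
  (h.deriv_equation i).isLittleO h.isOpen h.mem (h.continuousAt_field i) h.jet

/-- The second derivative of the equation of the surface still vanishes at `p`, where the only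
nonzero conormal is the one on the third axis. -/
theorem coeff_two (h : FrameJet U p X A g c I ξ a) (k i : Fin 2) :
    A k 2 i.castSucc p = g (i + k) := by
  have := (h.deriv_conormal k i.castSucc).apply_eq_zero h.isOpen h.mem (h.conormal_isLittleO i)
  simp only [Fin.sum_univ_three, h.conormal_apply, h.hess_apply] at this
  simpa [sub_eq_zero] using this

/-- On the tangent plane, the second differential is the metric `g` to the second order. -/
theorem hess_isLittleO (h : FrameJet U p X A g c I ξ a)
    (h2 : ∀ q ∈ U, ∀ k i : Fin 2, A k 2 i.castSucc q = g (i + k)) (i k : Fin 2) :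
    (fun q => g (i + k) * conormal g c I ξ a 2 q - hess g c I ξ a i.castSucc k.castSucc q)
      =o[𝓝 p] fun q => ‖q - p‖ ^ 2 := by
  -- In the derivative of a tangential conormal, the terms with the tangential conormals are of
  -- higher order and can be dropped; `h2` identifies the coefficient of the third one.
  have e := (h.deriv_conormal k i.castSucc).isLittleO h.isOpen h.mem (h.continuousAt_field k)
    (h.conormal_isLittleO i)
  have e0 := mul_isLittleO (h.continuousAt_coeff k 0 i.castSucc)
    (isLittleO_norm_sub_pow_of_le (m := 2) (by simp) (h.conormal_isLittleO 0))
  have e1 := mul_isLittleO (h.continuousAt_coeff k 1 i.castSucc)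
    (isLittleO_norm_sub_pow_of_le (m := 2) (by simp) (h.conormal_isLittleO 1))
  refine ((e.sub e0).sub e1).congr' ?_ EventuallyEq.rfl
  filter_upwards [h.isOpen.mem_nhds h.mem] with q hq
  simp only [Fin.sum_univ_three, h2 q hq, Fin.castSucc_zero, Fin.castSucc_one]
  ring

theorem deriv_hess_defect (h : FrameJet U p X A g c I ξ a) (i j k : Fin 2) :
    HasDerivAlong U (X k)
      (fun q => g (i + j) * conormal g c I ξ a 2 q - hess g c I ξ a i.castSucc j.castSucc q)
      fun q => g (i + j) *
          ((∑ s, A k s 2 q * conormal g c I ξ a s q) - hess g c I ξ a 2 k.castSucc q)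
        - (cubic c I ξ a i.castSucc j.castSucc k.castSucc q
          + (∑ s, A k s i.castSucc q * hess g c I ξ a s j.castSucc q)
          + ∑ s, A k s j.castSucc q * hess g c I ξ a i.castSucc s q) :=
  ((h.deriv_conormal k 2).const_mul h.isOpen _).sub h.isOpen (h.deriv_hess k _ _)

/-- The defect in `hess_isLittleO` vanishes beyond order two, so its derivative is zero at `p`. That
defect is available only because `h2` holds on all of `U`. -/
theorem coeff_cubic (h : FrameJet U p X A g c I ξ a)
    (h2 : ∀ q ∈ U, ∀ k i : Fin 2, A k 2 i.castSucc q = g (i + k)) (i j k : Fin 2) :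
    g (i + j) * A k 2 2 p = c (i + j + k)
      + (∑ s : Fin 2, A k s.castSucc i.castSucc p * g (s + j))
      + ∑ s : Fin 2, A k s.castSucc j.castSucc p * g (i + s) := by
  have := (h.deriv_hess_defect i j k).apply_eq_zero h.isOpen h.mem (h.hess_isLittleO h2 i j)
  simp only [h.conormal_apply, h.hess_apply_two_left, h.cubic_apply] at this
  simp only [Fin.sum_univ_castSucc (n := 2), h.hess_apply] at this
  simp [h.hess_apply_two_left, h.hess_apply_two_right, Fin.sum_univ_two] at this ⊢
  linarith

/-- On the tangent plane, the third differential of the quartic is determined to the first order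
by the cubic form `c` and by the mixed values of the second differential. -/
theorem cubic_isLittleO (h : FrameJet U p X A g c I ξ a)
    (h2 : ∀ q ∈ U, ∀ k i : Fin 2, A k 2 i.castSucc q = g (i + k))
    (h3 : ∀ q ∈ U, ∀ i j k : Fin 2, g (i + j) * A k 2 2 q = c (i + j + k)
      + (∑ s : Fin 2, A k s.castSucc i.castSucc q * g (s + j))
      + ∑ s : Fin 2, A k s.castSucc j.castSucc q * g (i + s)) (i j k : Fin 2) :
    (fun q => c (i + j + k) * conormal g c I ξ a 2 q
      - cubic c I ξ a i.castSucc j.castSucc k.castSucc q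
      - (g (i + j) * hess g c I ξ a 2 k.castSucc q + g (i + k) * hess g c I ξ a 2 j.castSucc q
        + g (j + k) * hess g c I ξ a i.castSucc 2 q)) =o[𝓝 p] fun q => ‖q - p‖ ^ 1 := by
  have e := (h.deriv_hess_defect i j k).isLittleO h.isOpen h.mem (h.continuousAt_field k)
    (h.hess_isLittleO h2 i j)
  -- The families `n`, `l` and `r` are the negligible contributions of the tangential conormals and
  -- of the metric defects in the two arguments. After their removal, `h3` collects the remaining
  -- multiples of the third conormal into `c (i + j + k)`.
  have n (s : Fin 2) := (mul_isLittleO (h.continuousAt_coeff k s.castSucc 2)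
    (isLittleO_norm_sub_pow_of_le (m := 1) (by simp) (h.conormal_isLittleO s))).const_mul_left
      (g (i + j))
  have l (s : Fin 2) := mul_isLittleO (h.continuousAt_coeff k s.castSucc i.castSucc)
    (isLittleO_norm_sub_pow_of_le (m := 1) (by simp) (h.hess_isLittleO h2 s j))
  have r (s : Fin 2) := mul_isLittleO (h.continuousAt_coeff k s.castSucc j.castSucc)
    (isLittleO_norm_sub_pow_of_le (m := 1) (by simp) (h.hess_isLittleO h2 i s))
  refine ((((((e.sub (n 0)).sub (n 1)).sub (l 0)).sub (l 1)).sub (r 0)).sub (r 1)).congr' ?_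
    EventuallyEq.rfl
  filter_upwards [h.isOpen.mem_nhds h.mem] with q hq
  have e3 := h3 q hq i j k
  have e2 := h2 q hq k
  have ei := e2 i
  have ej := e2 j
  simp only [Fin.sum_univ_three, Fin.sum_univ_two, Fin.castSucc_zero, Fin.castSucc_one, ei, ej]
    at e3 ⊢
  linear_combination conormal g c I ξ a 2 q * e3

/-- This is the last differentiation: the expression in `cubic_isLittleO` vanishes beyond order one,
so its derivative is zero at `p`. The terms with `g` come from the mixed values of the second
differential, which vanish at `p` but whose derivatives do not in general. -/
theorem coeff_quartic (h : FrameJet U p X A g c I ξ a)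
    (h2 : ∀ q ∈ U, ∀ k i : Fin 2, A k 2 i.castSucc q = g (i + k))
    (h3 : ∀ q ∈ U, ∀ i j k : Fin 2, g (i + j) * A k 2 2 q = c (i + j + k)
      + (∑ s : Fin 2, A k s.castSucc i.castSucc q * g (s + j))
      + ∑ s : Fin 2, A k s.castSucc j.castSucc q * g (i + s)) (i j k l : Fin 2) :
    c (i + j + k) * A l 2 2 p = I (i + j + k + l)
      + (∑ s : Fin 2, A l s.castSucc i.castSucc p * c (s + j + k))
      + (∑ s : Fin 2, A l s.castSucc j.castSucc p * c (i + s + k))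
      + (∑ s : Fin 2, A l s.castSucc k.castSucc p * c (i + j + s))
      + g (i + j) * (∑ s : Fin 2, A l s.castSucc 2 p * g (s + k))
      + g (i + k) * (∑ s : Fin 2, A l s.castSucc 2 p * g (s + j))
      + g (j + k) * ∑ s : Fin 2, A l s.castSucc 2 p * g (i + s) := by
  have hU := h.isOpen
  have key := ((((h.deriv_conormal l 2).const_mul hU (c (i + j + k))).sub hU
    (h.deriv_cubic l i.castSucc j.castSucc k.castSucc)).sub hU
    ((((h.deriv_hess l 2 k.castSucc).const_mul hU (g (i + j))).add hU
      ((h.deriv_hess l 2 j.castSucc).const_mul hU (g (i + k)))).add hU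
      ((h.deriv_hess l i.castSucc 2).const_mul hU (g (j + k))))).apply_eq_zero hU h.mem
    (h.cubic_isLittleO h2 h3 i j k)
  -- At `p` the third axis has no `x` or `y` component, so the differentials of a polynomial in `x,
  -- y` vanish on it.
  have c0 (m n : Fin 3) : cubic c I ξ a 2 m n p = 0 := by simp [cubic, h.frame_apply]
  have c1 (m n : Fin 3) : cubic c I ξ a m 2 n p = 0 := by simp [cubic, h.frame_apply]
  have c2 (m n : Fin 3) : cubic c I ξ a m n 2 p = 0 := by simp [cubic, h.frame_apply]
  simp only [Fin.sum_univ_castSucc (n := 2), h.hess_apply, h.conormal_apply, h.cubic_apply,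
    h.quartic_apply] at key
  simp [h.hess_apply_two_left, h.hess_apply_two_right, c0, c1, c2, Fin.sum_univ_two] at key ⊢
  linarith

end FrameJet

/-! ### Coordinates in a moving frame -/

section Coordinates

variable {U : Set Plane} {e : Fin 3 → Plane → A3} {p : Plane}

/-- The matrix with the columns `e 0 q`, `e 1 q`, `e 2 q`. -/
def frameMatrix (e : Fin 3 → Plane → A3) (q : Plane) : Matrix (Fin 3) (Fin 3) ℝ :=
  Matrix.of fun b i => e i q b

/-- The `i`-th coordinate of a vector in the frame at `q`. -/
noncomputable def coord (e : Fin 3 → Plane → A3) (q : Plane) (i : Fin 3) : A3 →L[ℝ] ℝ :=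
  LinearMap.toContinuousLinearMap ((LinearMap.proj i).comp (frameMatrix e q)⁻¹.mulVecLin)

theorem coord_apply (q : Plane) (i : Fin 3) (v : A3) :
    coord e q i v = ∑ b, (frameMatrix e q)⁻¹ i b * v b := rfl

theorem isUnit_frameMatrix (h : LinearIndependent ℝ fun i => e i p) : IsUnit (frameMatrix e p) :=
  Matrix.linearIndependent_cols_iff_isUnit.1 h

theorem det_frameMatrix_ne_zero (h : LinearIndependent ℝ fun i => e i p) :
    (frameMatrix e p).det ≠ 0 :=
  ((Matrix.isUnit_iff_isUnit_det _).1 (isUnit_frameMatrix h)).ne_zero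

theorem coord_frame (h : LinearIndependent ℝ fun i => e i p) (i m : Fin 3) :
    coord e p i (e m p) = if i = m then 1 else 0 := by
  have := congr_fun₂ (Matrix.nonsing_inv_mul (frameMatrix e p)
    ((Matrix.isUnit_iff_isUnit_det _).1 (isUnit_frameMatrix h))) i m
  rwa [Matrix.mul_apply, Matrix.one_apply] at this

theorem sum_coord_smul (h : LinearIndependent ℝ fun i => e i p) (v : A3) :
    ∑ i, coord e p i v • e i p = v := by
  have h1 := Matrix.mul_nonsing_inv (frameMatrix e p)
    ((Matrix.isUnit_iff_isUnit_det _).1 (isUnit_frameMatrix h))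
  have h2 : (frameMatrix e p).mulVec ((frameMatrix e p)⁻¹.mulVec v) = v := by
    rw [Matrix.mulVec_mulVec, h1, Matrix.one_mulVec]
  ext b
  have h3 := congr_fun h2 b
  simp only [Matrix.mulVec, dotProduct] at h3
  rw [← h3, Finset.sum_apply]
  refine Finset.sum_congr rfl fun i _ => ?_
  simp [coord_apply, frameMatrix, mul_comm]

theorem contDiffOn_frameMatrix_inv (he : ∀ i, ContDiffOn ℝ ∞ (e i) U)
    (hli : ∀ q ∈ U, LinearIndependent ℝ fun i => e i q) (i b : Fin 3) :
    ContDiffOn ℝ ∞ (fun q => (frameMatrix e q)⁻¹ i b) U := by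
  have h (i b : Fin 3) : ContDiffOn ℝ ∞ (fun q => e i q b) U := contDiffOn_pi.1 (he i) b
  have hdet : ContDiffOn ℝ ∞ (fun q => (frameMatrix e q).det) U := by
    simp only [Matrix.det_fin_three, frameMatrix, Matrix.of_apply]
    fun_prop
  have hadj : ContDiffOn ℝ ∞ (fun q => (frameMatrix e q).adjugate i b) U := by
    fin_cases i <;> fin_cases b <;> simp [Matrix.adjugate_fin_three, frameMatrix] <;> fun_prop
  simp only [Matrix.inv_def, Matrix.smul_apply, Ring.inverse_eq_inv', smul_eq_mul]
  exact (hdet.inv fun q hq => det_frameMatrix_ne_zero (hli q hq)).mul hadj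

theorem contDiffOn_coord (he : ∀ i, ContDiffOn ℝ ∞ (e i) U)
    (hli : ∀ q ∈ U, LinearIndependent ℝ fun i => e i q) (i : Fin 3) {v : Plane → A3}
    (hv : ContDiffOn ℝ ∞ v U) : ContDiffOn ℝ ∞ (fun q => coord e q i (v q)) U := by
  simp only [coord_apply]
  exact ContDiffOn.sum fun b _ =>
    (contDiffOn_frameMatrix_inv he hli i b).mul (contDiffOn_pi.1 hv b)

theorem fderiv_coord {f : Plane → A3} {q : Plane} (i : Fin 3) (hf : DifferentiableAt ℝ f q)
    (v : Plane) : fderiv ℝ (fun q => coord e p i (f q)) q v = coord e p i (fderiv ℝ f q v) := by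
  have h : HasFDerivAt (fun q => coord e p i (f q)) _ q :=
    (coord e p i).hasFDerivAt.comp q hf.hasFDerivAt
  rw [h.fderiv]
  rfl

end Coordinates

/-! ### The invariant forms and the dual vector fields -/

section DualFields

variable {U : Set Plane} {r : Plane → A3} {e : Fin 3 → Plane → A3} {w₁ w₂ : OneForm}

theorem contDiffOn_oneForm {w : OneForm} (h : ∀ v, ContDiffOn ℝ ∞ (fun q => w q v) U) :
    ContDiffOn ℝ ∞ w U :=
  contDiffOn_clm_apply.2 h

theorem AreInvariantForms.eq_coord (hw : AreInvariantForms U r e w₁ w₂)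
    (hli : ∀ q ∈ U, LinearIndependent ℝ fun i => e i q) {q : Plane} (hq : q ∈ U) (v : Plane) :
    w₁ q v = coord e q 0 (fderiv ℝ r q v) ∧ w₂ q v = coord e q 1 (fderiv ℝ r q v) := by
  rw [hw q hq v]
  simp [coord_frame (hli q hq)]

theorem AreInvariantForms.contDiffOn (hU : IsOpen U) (hr : ContDiffOn ℝ ∞ r U)
    (he : ∀ i, ContDiffOn ℝ ∞ (e i) U)
    (hli : ∀ q ∈ U, LinearIndependent ℝ fun i => e i q) (hw : AreInvariantForms U r e w₁ w₂) :
    ContDiffOn ℝ ∞ w₁ U ∧ ContDiffOn ℝ ∞ w₂ U := by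
  have hr' : ContDiffOn ℝ ∞ (fderiv ℝ r) U := hr.fderiv_of_isOpen hU (by simp)
  exact ⟨contDiffOn_oneForm fun v => (contDiffOn_coord he hli 0
      (hr'.clm_apply contDiffOn_const)).congr fun q hq => (hw.eq_coord hli hq v).1,
    contDiffOn_oneForm fun v => (contDiffOn_coord he hli 1
      (hr'.clm_apply contDiffOn_const)).congr fun q hq => (hw.eq_coord hli hq v).2⟩

/-- The injective map `dr` factors through `(w₁, w₂)`, which is therefore injective, hence
surjective, on the plane. Preimages of the standard basis test a linear relation. -/
theorem AreInvariantForms.isCoframe (himm : ∀ q ∈ U, Function.Injective (fderiv ℝ r q))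
    (hw : AreInvariantForms U r e w₁ w₂) : IsCoframe U w₁ w₂ := by
  intro q hq
  have hinj : Function.Injective ((w₁ q).prod (w₂ q) : Plane →ₗ[ℝ] Plane) := by
    intro v v' h
    have h1 : w₁ q v = w₁ q v' := congr_arg Prod.fst h
    have h2 : w₂ q v = w₂ q v' := congr_arg Prod.snd h
    exact himm q hq (by rw [hw q hq, hw q hq, h1, h2])
  have hsurj := LinearMap.surjective_of_injective hinj
  rw [LinearIndependent.pair_iff]
  intro s t hst
  obtain ⟨x, hx⟩ := hsurj (1, 0)
  obtain ⟨y, hy⟩ := hsurj (0, 1)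
  have hx1 : w₁ q x = 1 := congr_arg Prod.fst hx
  have hx2 : w₂ q x = 0 := congr_arg Prod.snd hx
  have hy1 : w₁ q y = 0 := congr_arg Prod.fst hy
  have hy2 : w₂ q y = 1 := congr_arg Prod.snd hy
  have e1 := DFunLike.congr_fun hst x
  have e2 := DFunLike.congr_fun hst y
  simp [hx1, hx2] at e1
  simp [hy1, hy2] at e2
  exact ⟨e1, e2⟩

/-- The vector fields dual to a coframe. -/
noncomputable def dualField (w₁ w₂ : OneForm) (k : Fin 2) (q : Plane) : Plane :=
  (wedge w₁ w₂ q (1, 0) (0, 1))⁻¹ •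
    (![(w₂ q (0, 1), -w₂ q (1, 0)), (-w₁ q (0, 1), w₁ q (1, 0))] : Fin 2 → Plane) k

theorem contDiffOn_dualField (hw₁ : ContDiffOn ℝ ∞ w₁ U) (hw₂ : ContDiffOn ℝ ∞ w₂ U)
    (h : IsCoframe U w₁ w₂) (k : Fin 2) : ContDiffOn ℝ ∞ (dualField w₁ w₂ k) U := by
  have h1 (v : Plane) : ContDiffOn ℝ ∞ (fun q => w₁ q v) U := hw₁.clm_apply contDiffOn_const
  have h2 (v : Plane) : ContDiffOn ℝ ∞ (fun q => w₂ q v) U := hw₂.clm_apply contDiffOn_const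
  have hW : ContDiffOn ℝ ∞ (fun q => (wedge w₁ w₂ q (1, 0) (0, 1))⁻¹) U :=
    (((h1 _).mul (h2 _)).sub ((h1 _).mul (h2 _))).inv fun q hq => wedge_ne_zero h hq
  refine hW.smul ?_
  fin_cases k
  · exact (h2 _).prodMk (h2 _).neg
  · exact (h1 _).neg.prodMk (h1 _)

theorem sum_smul_dualField (h : IsCoframe U w₁ w₂) {q : Plane} (hq : q ∈ U) (v : Plane) :
    w₁ q v • dualField w₁ w₂ 0 q + w₂ q v • dualField w₁ w₂ 1 q = v := by
  have key : ∀ (L : Plane →L[ℝ] ℝ) (v : Plane), L v = v.1 * L (1, 0) + v.2 * L (0, 1) := by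
    intro L v
    have : v = v.1 • ((1 : ℝ), (0 : ℝ)) + v.2 • ((0 : ℝ), (1 : ℝ)) := by ext <;> simp
    conv_lhs => rw [this]
    rw [map_add, map_smul, map_smul, smul_eq_mul, smul_eq_mul]
  have hW := wedge_ne_zero h hq
  rw [key (w₁ q) v, key (w₂ q) v]
  simp only [wedge] at hW
  ext <;> simp [dualField, wedge] <;> field_simp <;> ring

/-- By `sum_smul_dualField` the two fields span the plane, so they are independent; the expansion of
each of them in terms of both is then unique. -/
theorem apply_dualField (h : IsCoframe U w₁ w₂) {q : Plane} (hq : q ∈ U) (k : Fin 2) :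
    w₁ q (dualField w₁ w₂ k q) = ![1, 0] k ∧ w₂ q (dualField w₁ w₂ k q) = ![0, 1] k := by
  have hli : LinearIndependent ℝ ![dualField w₁ w₂ 0 q, dualField w₁ w₂ 1 q] := by
    refine linearIndependent_of_top_le_span_of_card_eq_finrank (fun v _ => ?_) (by simp)
    rw [Matrix.range_cons, Matrix.range_cons, Matrix.range_empty, Set.union_empty,
      Set.singleton_union, Submodule.mem_span_pair]
    exact ⟨_, _, sum_smul_dualField h hq v⟩
  have e := sum_smul_dualField h hq (dualField w₁ w₂ k q)
  rw [LinearIndependent.pair_iff] at hli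
  fin_cases k
  · have := hli (w₁ q (dualField w₁ w₂ 0 q) - 1) (w₂ q (dualField w₁ w₂ 0 q)) (by
      rw [sub_smul, one_smul, sub_add_eq_add_sub, sub_eq_zero]; exact e)
    exact ⟨sub_eq_zero.1 this.1, this.2⟩
  · have := hli (w₁ q (dualField w₁ w₂ 1 q)) (w₂ q (dualField w₁ w₂ 1 q) - 1) (by
      rw [sub_smul, one_smul, ← add_sub_assoc, sub_eq_zero]; exact e)
    exact ⟨this.1, sub_eq_zero.1 this.2⟩

end DualFields

/-! ### The moving equation of a regular elliptical surface -/

/-- The coefficients of the second order form `x² + y²`. -/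
def metricCoeff : ℕ → ℝ
  | 0 => 1
  | 1 => 0
  | 2 => 1
  | _ => 0

/-- The coefficients of the third order form `x³ - 3 x y²`. -/
def cubicCoeff : ℕ → ℝ
  | 0 => 1
  | 1 => 0
  | 2 => -1
  | _ => 0

/-- The fundamental curvatures at a point, indexed by the order of differentiation in `y`. -/
def Curvatures.coeff (K : Curvatures) (p : Plane) : ℕ → ℝ
  | 0 => K.I40 p
  | 1 => K.I31 p
  | 2 => K.I22 p
  | 3 => K.I13 p
  | _ => K.I04 p

/-- The coefficients of the derivatives of the moving frame along the dual vector fields. -/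
noncomputable def frameCoeff (e : Fin 3 → Plane → A3) (w₁ w₂ : OneForm) (k : Fin 2) (s m : Fin 3)
    (q : Plane) : ℝ :=
  coord e q s (fderiv ℝ (e m) q (dualField w₁ w₂ k q))

section MovingFrame

variable {U : Set Plane} {r : Plane → A3} {e : Fin 3 → Plane → A3} {w₁ w₂ : OneForm}
  {K : Curvatures}

theorem IsMovingFrame.linearIndependent (he : IsMovingFrame U r e) :
    ∀ q ∈ U, LinearIndependent ℝ fun i => e i q := fun q hq => (he.standard q hq).1

theorem contDiffOn_frameCoeff (hr : IsRegularElliptical U r) (he : IsMovingFrame U r e)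
    (hw : AreInvariantForms U r e w₁ w₂) (k : Fin 2) (s m : Fin 3) :
    ContDiffOn ℝ ∞ (frameCoeff e w₁ w₂ k s m) U := by
  obtain ⟨h1, h2⟩ := hw.contDiffOn hr.isOpen hr.smooth he.smooth he.linearIndependent
  have hX := contDiffOn_dualField h1 h2 (hw.isCoframe hr.immersion) k
  exact contDiffOn_coord he.smooth he.linearIndependent s
    (((he.smooth m).fderiv_of_isOpen hr.isOpen (by simp)).clm_apply hX)

theorem jet0_eq (K : Curvatures) (p : Plane) (s : ℝ × ℝ) :
    jet0 metricCoeff cubicCoeff (K.coeff p) s.1 s.2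
      = (s.1 ^ 2 + s.2 ^ 2) / 2 + (s.1 ^ 3 - 3 * s.1 * s.2 ^ 2) / 6
      + (K.I40 p * s.1 ^ 4 + 4 * K.I31 p * s.1 ^ 3 * s.2 + 6 * K.I22 p * s.1 ^ 2 * s.2 ^ 2
        + 4 * K.I13 p * s.1 * s.2 ^ 3 + K.I04 p * s.2 ^ 4) / 24 := by
  simp only [jet0, metricCoeff, cubicCoeff, Curvatures.coeff]
  ring

theorem frameJet (hr : IsRegularElliptical U r) (he : IsMovingFrame U r e)
    (hw : AreInvariantForms U r e w₁ w₂) (hK : AreFundamentalCurvatures U r e K) {p : Plane}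
    (hp : p ∈ U) :
    FrameJet U p (dualField w₁ w₂) (frameCoeff e w₁ w₂) metricCoeff cubicCoeff (K.coeff p)
      (fun i q => coord e p i (r q - r p)) (fun i m q => coord e p i (e m q)) := by
  have hli := he.linearIndependent
  obtain ⟨h1, h2⟩ := hw.contDiffOn hr.isOpen hr.smooth he.smooth hli
  have hco := hw.isCoframe hr.immersion
  have hrd : ∀ q ∈ U, DifferentiableAt ℝ r q := fun q hq =>
    (hr.smooth.contDiffAt (hr.isOpen.mem_nhds hq)).differentiableAt (by simp)
  have hed : ∀ m, ∀ q ∈ U, DifferentiableAt ℝ (e m) q := fun m q hq =>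
    ((he.smooth m).contDiffAt (hr.isOpen.mem_nhds hq)).differentiableAt (by simp)
  refine ⟨hr.isOpen, hp, fun k => ?_, fun k s m => ?_, fun k i => ⟨?_, fun q hq => ?_⟩,
    fun k i m => ⟨?_, fun q hq => ?_⟩, fun i => by simp, fun i m => coord_frame (hli p hp) i m, ?_⟩
  · exact ((contDiffOn_dualField h1 h2 hco k).contDiffAt (hr.isOpen.mem_nhds hp)).continuousAt
  · exact ((contDiffOn_frameCoeff hr he hw k s m).contDiffAt (hr.isOpen.mem_nhds hp)).continuousAt
  · exact (coord e p i).contDiff.comp_contDiffOn (hr.smooth.sub contDiffOn_const)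
  · rw [fderiv_coord i ((hrd q hq).sub_const _), fderiv_sub_const, hw q hq,
      (apply_dualField hco hq k).1, (apply_dualField hco hq k).2]
    fin_cases k <;> simp
  · exact (coord e p i).contDiff.comp_contDiffOn (he.smooth m)
  · rw [fderiv_coord i (hed m q hq),
      ← sum_coord_smul (hli q hq) (fderiv ℝ (e m) q (dualField w₁ w₂ k q)), map_sum]
    simp only [map_smul, smul_eq_mul, frameCoeff]
  -- The Taylor remainder is given in the coordinates `x, y` of the graph. These are the first two
  -- frame coordinates of `r q - r p`, which are `O(‖q - p‖)`, so the order four carries over to the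
  -- parameter plane.
  · obtain ⟨u, ⟨-, hu⟩, hT⟩ := hK p hp
    have hφ : HasFDerivAt (fun q => ((coord e p 0 (r q - r p), coord e p 1 (r q - r p)) : ℝ × ℝ))
        _ p := ((coord e p 0).hasFDerivAt.comp p ((hrd p hp).hasFDerivAt.sub_const (r p))).prodMk
      ((coord e p 1).hasFDerivAt.comp p ((hrd p hp).hasFDerivAt.sub_const (r p)))
    have hO := hφ.isBigO_sub
    have ht := hφ.continuousAt.tendsto
    simp only [sub_self, map_zero] at hO ht
    have hcomp := (hT.comp_tendsto ht).trans_isBigO ((hO.norm_norm.congr_left fun q => by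
      rw [← Prod.zero_eq_mk, sub_zero]).pow 4)
    refine hcomp.congr' ?_ EventuallyEq.rfl
    filter_upwards [hu] with q ⟨x, y, hq⟩
    have hc (i : Fin 3) : coord e p i (r q - r p) = ![x, y, u (x, y)] i := by
      rw [hq, add_assoc, add_assoc, add_sub_cancel_left]
      simp only [map_add, map_smul, coord_frame (hli p hp), smul_eq_mul]
      fin_cases i <;> simp
    simp only [Function.comp_apply, ← jet0_eq, hc]
    simp

/-- The relations of order two fix the 4 coefficients `A k 2 i` with `i < 2`. Up to symmetry, those
of orders three and four give 6 and 8 equations for the 14 others. The resulting linear system has a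
unique solution. -/
theorem frameCoeff_eq (hr : IsRegularElliptical U r) (he : IsMovingFrame U r e)
    (hw : AreInvariantForms U r e w₁ w₂) (hK : AreFundamentalCurvatures U r e K) {p : Plane}
    (hp : p ∈ U) (s m : Fin 3) :
    frameCoeff e w₁ w₂ 0 s m p = R1 K p s m ∧ frameCoeff e w₁ w₂ 1 s m p = R2 K p s m := by
  -- The jet data are taken at every `q`, not only at `p`: `metricCoeff` and `cubicCoeff` do not
  -- depend on the point, so `h2` and `h3` are identities on `U`.
  have J {q : Plane} (hq : q ∈ U) := frameJet hr he hw hK hq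
  have h2 : ∀ q ∈ U, ∀ k i : Fin 2, frameCoeff e w₁ w₂ k 2 i.castSucc q = metricCoeff (i + k) :=
    fun q hq k i => (J hq).coeff_two k i
  have h3 := fun q hq i j k => (J (q := q) hq).coeff_cubic h2 i j k
  have h4 := (J hp).coeff_quartic h2 h3
  have a2 := h2 p hp
  have a3 := h3 p hp
  generalize frameCoeff e w₁ w₂ = A at a2 a3 h4 ⊢
  clear h2 h3
  have k0 := a2 0 0
  have k1 := a2 0 1
  have k2 := a2 1 0
  have k3 := a2 1 1
  have c1 := a3 0 0 0
  have c2 := a3 0 0 1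
  have c3 := a3 0 1 0
  have c4 := a3 0 1 1
  have c5 := a3 1 1 0
  have c6 := a3 1 1 1
  have q1 := h4 0 0 0 0
  have q2 := h4 0 0 1 0
  have q3 := h4 0 1 1 0
  have q4 := h4 1 1 1 0
  have q5 := h4 0 0 0 1
  have q6 := h4 0 0 1 1
  have q7 := h4 0 1 1 1
  have q8 := h4 1 1 1 1
  simp [metricCoeff] at k0 k1 k2 k3
  simp [Fin.sum_univ_two, metricCoeff, cubicCoeff] at c1 c2 c3 c4 c5 c6
  simp [Fin.sum_univ_two, metricCoeff, cubicCoeff, Curvatures.coeff] at q1 q2 q3 q4 q5 q6 q7 q8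
  fin_cases s <;> fin_cases m <;> simp [R1, R2] <;> constructor <;> linarith

end MovingFrame

/-! ### Smoothness of the curvatures, the moving equation and the structure equation -/

section Conclusions

variable {U : Set Plane} {r : Plane → A3} {e : Fin 3 → Plane → A3} {w₁ w₂ : OneForm}
  {K : Curvatures}

/-- The curvatures are given only pointwise, by Taylor coefficients. The third columns of `R1` and
`R2` can be solved for them, which expresses them as affine combinations of the smooth functions
`frameCoeff`. -/
theorem fundamentalCurvatures_smooth (hr : IsRegularElliptical U r) (he : IsMovingFrame U r e)
    (hw : AreInvariantForms U r e w₁ w₂) (hK : AreFundamentalCurvatures U r e K) :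
    K.Smooth U := by
  have hA := contDiffOn_frameCoeff hr he hw
  have h := fun p hp s m => frameCoeff_eq hr he hw hK (p := p) hp s m
  have h22 : ContDiffOn ℝ ∞ K.I22 U := by
    refine ((((hA 0 2 2).sub (contDiffOn_const.mul (hA 0 0 2))).add
      contDiffOn_const).div_const 2).congr (f := fun q => (frameCoeff e w₁ w₂ 0 2 2 q
        - 2 * frameCoeff e w₁ w₂ 0 0 2 q + 1) / 2) fun q hq => ?_
    rw [(h q hq 2 2).1, (h q hq 0 2).1]
    simp [R1]
    ring
  refine ⟨?_, ?_, h22, ?_, ?_⟩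
  · refine (((contDiffOn_const.sub (hA 0 2 2)).sub
      (contDiffOn_const.mul (hA 0 0 2))).div_const 2).congr
        (f := fun q => (3 - frameCoeff e w₁ w₂ 0 2 2 q
        - 6 * frameCoeff e w₁ w₂ 0 0 2 q) / 2) fun q hq => ?_
    rw [(h q hq 2 2).1, (h q hq 0 2).1]
    simp [R1]
    ring
  · refine (((hA 1 2 2).add (contDiffOn_const.mul (hA 1 0 2))).div_const (-2)).congr
        (f := fun q => (frameCoeff e w₁ w₂ 1 2 2 q
        + 6 * frameCoeff e w₁ w₂ 1 0 2 q) / (-2)) fun q hq => ?_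
    rw [(h q hq 2 2).2, (h q hq 0 2).2]
    simp [R2]
    ring
  · refine (((hA 1 2 2).sub (contDiffOn_const.mul (hA 1 0 2))).div_const 2).congr
        (f := fun q => (frameCoeff e w₁ w₂ 1 2 2 q
        - 2 * frameCoeff e w₁ w₂ 1 0 2 q) / 2) fun q hq => ?_
    rw [(h q hq 2 2).2, (h q hq 0 2).2]
    simp [R2]
    ring
  · refine ((contDiffOn_const.sub h22).sub (contDiffOn_const.mul (hA 1 1 2))).congr
        (f := fun q => 2 - K.I22 q - 4 * frameCoeff e w₁ w₂ 1 1 2 q) fun q hq => ?_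
    rw [(h q hq 1 2).2]
    simp [R2]
    ring

theorem movingEquation (hr : IsRegularElliptical U r) (he : IsMovingFrame U r e)
    (hw : AreInvariantForms U r e w₁ w₂) (hK : AreFundamentalCurvatures U r e K) :
    MovingEquation U r e (Omega w₁ w₂ K) := by
  intro p hp v j
  have hE (m : Fin 3) : fderiv ℝ (e m) p v = ∑ s, wForm w₁ w₂ K s m p v • e s p := by
    have hd (k : Fin 2) := sum_coord_smul (he.linearIndependent p hp)
      (fderiv ℝ (e m) p (dualField w₁ w₂ k p))
    conv_lhs => rw [← sum_smul_dualField (hw.isCoframe hr.immersion) hp v]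
    rw [map_add, map_smul, map_smul, ← hd 0, ← hd 1, Finset.smul_sum, Finset.smul_sum,
      ← Finset.sum_add_distrib]
    refine Finset.sum_congr rfl fun s _ => ?_
    have h := frameCoeff_eq hr he hw hK hp s m
    unfold frameCoeff at h
    rw [h.1, h.2, smul_smul, smul_smul, ← add_smul]
    simp only [wForm, add_apply, smul_apply, smul_eq_mul]
    congr 1
    ring
  fin_cases j
  · simpa [Fin.sum_univ_four, Fin.sum_univ_three, Omega] using hE 0
  · simpa [Fin.sum_univ_four, Fin.sum_univ_three, Omega] using hE 1
  · simpa [Fin.sum_univ_four, Fin.sum_univ_three, Omega] using hE 2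
  · simpa [Fin.sum_univ_four, Omega] using hw p hp v

/-- The moving equation of smooth fields of affine frames implies the structure equation, by the
symmetry of second derivatives. -/
theorem MovingEquation.structureEquation {Ω : Matrix (Fin 4) (Fin 4) OneForm} (hU : IsOpen U)
    (hr : ContDiffOn ℝ ∞ r U) (he : ∀ i, ContDiffOn ℝ ∞ (e i) U)
    (hli : ∀ q ∈ U, LinearIndependent ℝ fun i => e i q)
    (hΩ : ∀ i j, ContDiffOn ℝ ∞ (Ω i j) U) (hΩ3 : ∀ j, Ω 3 j = 0)
    (h : MovingEquation U r e Ω) : StructureEquation U Ω := by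
  intro p hp u v i j
  have hG (j : Fin 4) : ContDiffOn ℝ ∞ (![e 0, e 1, e 2, r] j) U := by
    fin_cases j
    exacts [he 0, he 1, he 2, hr]
  set G : Fin 4 → Plane → A3 := ![e 0, e 1, e 2, r]
  have dG (j : Fin 4) : DifferentiableAt ℝ (G j) p :=
    ((hG j).contDiffAt (hU.mem_nhds hp)).differentiableAt (by simp)
  have dΩ (i j : Fin 4) : DifferentiableAt ℝ (Ω i j) p :=
    ((hΩ i j).contDiffAt (hU.mem_nhds hp)).differentiableAt (by simp)
  have d2 (u v : Plane) : fderiv ℝ (fderiv ℝ (G j)) p u v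
      = ∑ i, (fderiv ℝ (Ω i j) p u v • G i p + Ω i j p v • fderiv ℝ (G i) p u) := by
    have hd : DifferentiableAt ℝ (fderiv ℝ (G j)) p :=
      (((hG j).contDiffAt (hU.mem_nhds hp)).fderiv_right (m := ∞) (by simp)).differentiableAt
        (by simp)
    have e1 : fderiv ℝ (fun q => fderiv ℝ (G j) q v) p u = fderiv ℝ (fderiv ℝ (G j)) p u v := by
      rw [fderiv_clm_apply hd (differentiableAt_const v)]
      simp
    have e2 : (fun q => fderiv ℝ (G j) q v) =ᶠ[𝓝 p] fun q => ∑ i, Ω i j q v • G i q := by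
      filter_upwards [hU.mem_nhds hp] with q hq using h q hq v j
    rw [← e1, e2.fderiv_eq]
    have hΩv (i : Fin 4) : DifferentiableAt ℝ (fun q => Ω i j q v) p :=
      (dΩ i j).clm_apply (differentiableAt_const v)
    rw [fderiv_fun_sum fun i _ => (hΩv i).fun_smul (dG i), sum_apply]
    refine Finset.sum_congr rfl fun i _ => ?_
    rw [fderiv_fun_smul (hΩv i) (dG i), fderiv_clm_apply (dΩ i j) (differentiableAt_const v)]
    simp [add_comm]
  have hsymm : fderiv ℝ (fderiv ℝ (G j)) p u v = fderiv ℝ (fderiv ℝ (G j)) p v u :=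
    (((hG j).contDiffAt (hU.mem_nhds hp)).isSymmSndFDerivAt
      (by simpa using WithTop.coe_le_coe.2 (le_top : (2 : ℕ∞) ≤ ⊤))).eq u v
  -- Antisymmetrizing the second derivative of `G j` gives the `j`-th column of `dΩ + Ω ∧ Ω`,
  -- applied to the frame; the moving equation replaces each `dG` by `Ω`.
  have hsum : ∑ k, (d (Ω k j) p u v + ∑ i, wedge (Ω k i) (Ω i j) p u v) • G k p = 0 := by
    have e1 (k : Fin 4) (u : Plane) : fderiv ℝ (G k) p u = ∑ i, Ω i k p u • G i p := h p hp u k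
    rw [d2, d2] at hsymm
    simp only [e1, Finset.sum_add_distrib, Finset.smul_sum] at hsymm
    rw [Finset.sum_comm (f := fun i k => Ω i j p v • Ω k i p u • G k p),
      Finset.sum_comm (f := fun i k => Ω i j p u • Ω k i p v • G k p)] at hsymm
    simp only [add_smul, Finset.sum_add_distrib, Finset.sum_smul, wedge, sub_smul, mul_smul,
      Finset.sum_sub_distrib, d_apply (dΩ _ _)]
    have comm (a b : ℝ) (x : A3) : a • b • x = b • a • x := smul_comm a b x
    rw [sub_add_sub_comm, sub_eq_zero]
    simpa only [comm (Ω _ j p _)] using hsymm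
  -- The position vector `G 3` is not independent of the axes, but its coefficient vanishes since
  -- the last row of `Ω` is zero; this leaves a relation among the axes only.
  have h3 (j : Fin 4) : d (Ω 3 j) p u v + ∑ k, wedge (Ω 3 k) (Ω k j) p u v = 0 := by
    simp [hΩ3, d_zero, wedge]
  rw [Fin.sum_univ_castSucc] at hsum
  rw [show Fin.last 3 = 3 from rfl, h3, zero_smul, add_zero] at hsum
  have hGe (k : Fin 3) : G k.castSucc p = e k p := by fin_cases k <;> rfl
  simp only [hGe] at hsum
  have hz := Fintype.linearIndependent_iff.1 (hli p hp) _ hsum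
  induction i using Fin.lastCases with
  | last => exact h3 j
  | cast i => exact hz i

theorem contDiffOn_Omega (h₁ : ContDiffOn ℝ ∞ w₁ U) (h₂ : ContDiffOn ℝ ∞ w₂ U)
    (hK : K.Smooth U) (i j : Fin 4) : ContDiffOn ℝ ∞ (Omega w₁ w₂ K i j) U := by
  obtain ⟨h40, h31, h22, h13, h04⟩ := hK
  have hR1 (i j : Fin 3) : ContDiffOn ℝ ∞ (fun q => R1 K q i j) U := by
    clear h₁ h₂
    fin_cases i <;> fin_cases j <;> simp [R1] <;> fun_prop
  have hR2 (i j : Fin 3) : ContDiffOn ℝ ∞ (fun q => R2 K q i j) U := by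
    clear h₁ h₂
    fin_cases i <;> fin_cases j <;> simp [R2] <;> fun_prop
  have hw (i j : Fin 3) : ContDiffOn ℝ ∞ (wForm w₁ w₂ K i j) U :=
    ((hR1 i j).smul h₁).add ((hR2 i j).smul h₂)
  have h0 : ContDiffOn ℝ ∞ (0 : OneForm) U := contDiffOn_const
  fin_cases i <;> fin_cases j <;> first | exact hw _ _ | exact h₁ | exact h₂ | exact h0

end Conclusions

end AffineSurface

theorem theorem4p4 :
    (∀ (U : Set AffineSurface.Plane) (r : AffineSurface.Plane → AffineSurface.A3)
        (e : Fin 3 → AffineSurface.Plane → AffineSurface.A3)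
        (w₁ w₂ : AffineSurface.OneForm) (K : AffineSurface.Curvatures),
        AffineSurface.IsRegularElliptical U r →
        AffineSurface.IsMovingFrame U r e →
        AffineSurface.AreInvariantForms U r e w₁ w₂ →
        AffineSurface.AreFundamentalCurvatures U r e K →
        (ContDiffOn ℝ ∞ w₁ U ∧ ContDiffOn ℝ ∞ w₂ U ∧ AffineSurface.IsCoframe U w₁ w₂ ∧
          K.Smooth U) ∧
        AffineSurface.MovingEquation U r e (AffineSurface.Omega w₁ w₂ K) ∧
        AffineSurface.StructureEquation U (AffineSurface.Omega w₁ w₂ K) ∧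
        AffineSurface.CompatibilityConditions U w₁ w₂ K) ∧
    (∀ (U : Set AffineSurface.Plane) (w₁ w₂ : AffineSurface.OneForm)
        (K : AffineSurface.Curvatures),
        IsOpen U → ContDiffOn ℝ ∞ w₁ U → ContDiffOn ℝ ∞ w₂ U →
        AffineSurface.IsCoframe U w₁ w₂ → K.Smooth U →
        (AffineSurface.StructureEquation U (AffineSurface.Omega w₁ w₂ K) ↔
          AffineSurface.CompatibilityConditions U w₁ w₂ K)) := by
  refine ⟨fun U r e w₁ w₂ K hr he hw hK => ?_, fun U w₁ w₂ K hU h₁ h₂ h hK =>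
    AffineSurface.structureEquation_iff_compatibilityConditions hU h₁ h₂ h hK⟩
  obtain ⟨h₁, h₂⟩ := hw.contDiffOn hr.isOpen hr.smooth he.smooth he.linearIndependent
  have hco := hw.isCoframe hr.immersion
  have hKs := AffineSurface.fundamentalCurvatures_smooth hr he hw hK
  have hM := AffineSurface.movingEquation hr he hw hK
  have hS : AffineSurface.StructureEquation U (AffineSurface.Omega w₁ w₂ K) :=
    hM.structureEquation hr.isOpen hr.smooth he.smooth he.linearIndependent
      (AffineSurface.contDiffOn_Omega h₁ h₂ hKs) fun j => by
        fin_cases j <;> rfl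
  exact ⟨⟨h₁, h₂, hco, hKs⟩, hM, hS,
    (AffineSurface.structureEquation_iff_compatibilityConditions hr.isOpen h₁ h₂ hco hKs).1 hS⟩
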